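/- Let $F$ be a nonarchimedean local field of odd residual characteristic, with ring of integers $\mathcal O_F$, maximal ideal $P_F$ and uniformizer $\varpi$. Let $E=F(\alpha)$ be the unramified quadratic extension of $F$, where $\alpha^2=z\in\mathcal O_F^\times$ is not a square in $F$, and let $a\mapsto\bar a$ be its conjugation. Let $D=E\oplus E\delta$ be the quaternion division algebra over $F$ with $\delta^2=\varpi$ and $\delta a=\bar a\delta$ for $a\in E$, with reduced norm $N_{D/F}$ and reduced trace $\mathrm{Tr}_{D/F}$, valuation $v_D=v_F\circ N_{D/F}$, ring of integers $\mathcal O_D=\mathcal O_E+\mathcal O_E\delta$, and $P_D^k=\mathcal O_D\delta^k$. Let $E^1$ and $D^1$ be the groups of elements of norm one in $E$ and $D$, let $E^0$ and $D^0$ be the sets of elements of trace zero in $E$ and $D$, and put $D^1_k=\{x\in D^1: x-1\in P_D^k\}$, which is a normal subgroup of $D^1$. Let $$U(2)=\{x\in GL_2(E): xJ\bar x^{t}=J\},\qquad J=\mathrm{diag}(1,-\varpi).$$ Then $U(2)=D^1\rtimes E^1$, where $a+c\delta\in D^1$ is identified with $\begin{pmatrix}a&c\\ \varpi\bar c&\bar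 a\end{pmatrix}$ and $\lambda\in E^1$ (the semidirect factor) with $\mathrm{diag}(1,\lambda)$. Let $m\ge 1$, $n=2m$, and suppose that $r=m+1$ is odd. Then $$E^1D^1_{r-1}/D^1_{n+1}=E^1D^1_r/D^1_{n+1},\qquad\text{and hence}\qquad E^1D^1_{r-1}=E^1D^1_r.$$ Let $\psi$ be an additive character of $F$ with conductor $P_F$ (trivial on $P_F$, nontrivial on $\mathcal O_F$). Let $\beta\in D^0$ with $v_D(\beta)=-n$, put $\psi_\beta(h)=\psi(\mathrm{Tr}_{D/F}(\beta(h-1)))$ for $h\in D^1_r$, and let $\gamma,\zeta$ be continuous characters of $E^1$ with $\gamma=\psi_\beta$ on $E^1\cap D^1_r$. Consider the formula $$\gamma_{(\beta,\zeta)}(\lambda x,\lambda')=\gamma(\lambda)\,\psi_\beta(x)\,\zeta(\lambda'),\qquad \lambda,\lambda'\in E^1,\ x\in D^1_r,\qquad(*)$$ on $E^1D^1_{r-1}\rtimes E^1=E^1D^1_r\rtimes E^1$. (i) If $\beta\in E^0$, then there is exactly one character $\gamma_{(\beta,\zeta)}$ of $E^1D^1_{r-1}\rtimes E^1$ satisfying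 $(*)$. (ii) Whenever $\beta\in D^0$ is such that $(*)$ defines a character $\gamma_{(\beta,\zeta)}$ of $E^1D^1_{r-1}\rtimes E^1$ (in particular for every $\beta\in E^0$), the (compactly) induced representation $\mathrm{Ind}(U(2),E^1D^1_{r-1}\rtimes E^1;\gamma_{(\beta,\zeta)})$ is an irreducible admissible representation of $U(2)$. -/

import Mathlib

open scoped Quaternion ValuativeRel Matrix Pointwise

noncomputable section

/-! ### Topology of a quadratic algebra -/

section QuadraticTopology

variable {R : Type*} [CommRing R] [TopologicalSpace R] {a b : R}

/-- The topology of `R × R` transported along the coordinates `x + y ω ↦ (x, y)`. -/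
instance quadraticAlgebraTopology : TopologicalSpace (QuadraticAlgebra R a b) :=
  TopologicalSpace.induced (fun x => (x.re, x.im)) inferInstance

theorem QuadraticAlgebra.continuous_re' :
    Continuous (QuadraticAlgebra.re : QuadraticAlgebra R a b → R) :=
  continuous_fst.comp (continuous_induced_dom (f := fun x : QuadraticAlgebra R a b => (x.re, x.im)))

theorem QuadraticAlgebra.continuous_im' :
    Continuous (QuadraticAlgebra.im : QuadraticAlgebra R a b → R) :=
  continuous_snd.comp (continuous_induced_dom (f := fun x : QuadraticAlgebra R a b => (x.re, x.im)))

instance [IsTopologicalRing R] : IsTopologicalRing (QuadraticAlgebra R a b) where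
  continuous_add := by
    refine continuous_induced_rng.2 (Continuous.prodMk ?_ ?_)
    · exact (QuadraticAlgebra.continuous_re'.comp continuous_fst).add
        (QuadraticAlgebra.continuous_re'.comp continuous_snd)
    · exact (QuadraticAlgebra.continuous_im'.comp continuous_fst).add
        (QuadraticAlgebra.continuous_im'.comp continuous_snd)
  continuous_mul := by
    have h1 := (QuadraticAlgebra.continuous_re' (a := a) (b := b)).comp
      (continuous_fst (X := QuadraticAlgebra R a b) (Y := QuadraticAlgebra R a b))
    have h2 := (QuadraticAlgebra.continuous_re' (a := a) (b := b)).comp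
      (continuous_snd (X := QuadraticAlgebra R a b) (Y := QuadraticAlgebra R a b))
    have h3 := (QuadraticAlgebra.continuous_im' (a := a) (b := b)).comp
      (continuous_fst (X := QuadraticAlgebra R a b) (Y := QuadraticAlgebra R a b))
    have h4 := (QuadraticAlgebra.continuous_im' (a := a) (b := b)).comp
      (continuous_snd (X := QuadraticAlgebra R a b) (Y := QuadraticAlgebra R a b))
    refine continuous_induced_rng.2 (Continuous.prodMk ?_ ?_)
    · exact (h1.mul h2).add (((continuous_const (y := a)).mul h3).mul h4)
    · exact ((h1.mul h4).add (h3.mul h2)).add (((continuous_const (y := b)).mul h3).mul h4)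
  continuous_neg := by
    refine continuous_induced_rng.2 (Continuous.prodMk ?_ ?_)
    · exact QuadraticAlgebra.continuous_re'.neg
    · exact QuadraticAlgebra.continuous_im'.neg

end QuadraticTopology

/-! ### Compact induction and admissibility -/

section Induction

variable {G : Type*} [Group G] [TopologicalSpace G]

/-- The space of the compact induction of the character `χ` from `H` to `G`: functions on `G` with
`f (h g) = χ h * f g`, right invariant under some open subgroup, and with compact support
modulo `H`. -/
def cIndSpace (H : Subgroup G) (χ : H →* ℂˣ) : Submodule ℂ (G → ℂ) where
  carrier := {f | (∀ (h : H) (g : G), f (h * g) = χ h * f g) ∧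
    (∃ K : Subgroup G, IsOpen (K : Set G) ∧ ∀ g, ∀ k ∈ K, f (g * k) = f g) ∧
    (∃ C : Set G, IsCompact C ∧ ∀ g, f g ≠ 0 → ∃ h ∈ H, ∃ c ∈ C, g = h * c)}
  zero_mem' := ⟨fun _ _ => by simp, ⟨⊤, by simp, fun _ _ _ => rfl⟩,
    ⟨∅, isCompact_empty, fun _ h => (h rfl).elim⟩⟩
  add_mem' := by
    rintro f f' ⟨h1, ⟨K, hK, hf⟩, C, hC, h2⟩ ⟨h1', ⟨K', hK', hf'⟩, C', hC', h2'⟩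
    refine ⟨fun h g => ?_, ⟨K ⊓ K', hK.inter hK', fun g k hk => ?_⟩,
      C ∪ C', hC.union hC', fun g hg => ?_⟩
    · simp only [Pi.add_apply, h1, h1', mul_add]
    · simp only [Pi.add_apply, hf g k hk.1, hf' g k hk.2]
    · by_cases hz : f g = 0
      · have : f' g ≠ 0 := fun h => hg (by simp [hz, h])
        obtain ⟨h, hh, c, hc, e⟩ := h2' g this
        exact ⟨h, hh, c, Or.inr hc, e⟩
      · obtain ⟨h, hh, c, hc, e⟩ := h2 g hz
        exact ⟨h, hh, c, Or.inl hc, e⟩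
  smul_mem' := by
    rintro t f ⟨h1, ⟨K, hK, hf⟩, C, hC, h2⟩
    refine ⟨fun h g => ?_, ⟨K, hK, fun g k hk => ?_⟩, C, hC, fun g hg => h2 g fun h => hg ?_⟩
    · simp only [Pi.smul_apply, smul_eq_mul, h1]; ring
    · simp only [Pi.smul_apply, hf g k hk]
    · simp [h]

/-- `Ind(G, H; χ)`: the action of `G` on `cIndSpace H χ` by right translation. -/
def cInd [IsTopologicalGroup G] (H : Subgroup G) (χ : H →* ℂˣ) :
    Representation ℂ G (cIndSpace H χ) where
  toFun x :=
    { toFun := fun f => ⟨fun g => (f : G → ℂ) (g * x), by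
        obtain ⟨f, h1, ⟨K, hK, hf⟩, C, hC, h2⟩ := f
        refine ⟨fun h g => ?_, ⟨K.comap (MulAut.conj x⁻¹).toMonoidHom, ?_, fun g k hk => ?_⟩,
          (fun c => c * x⁻¹) '' C, hC.image (continuous_mul_const _), fun g hg => ?_⟩
        · simpa only [mul_assoc] using h1 h (g * x)
        · refine hK.preimage (f := fun k => x⁻¹ * k * x⁻¹⁻¹) ?_
          fun_prop
        · have hk' : x⁻¹ * k * x⁻¹⁻¹ ∈ K := hk
          have := hf (g * x) _ hk'
          simpa [mul_assoc] using this
        · obtain ⟨h, hh, c, hc, e⟩ := h2 _ hg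
          exact ⟨h, hh, c * x⁻¹, ⟨c, hc, rfl⟩, by rw [← mul_assoc, ← e]; simp⟩⟩
      map_add' := fun _ _ => rfl
      map_smul' := fun _ _ => rfl }
  map_one' := by
    ext f g
    simp
  map_mul' x y := by
    ext f g
    simp [mul_assoc]

/-- A smooth representation whose spaces of vectors fixed by open subgroups are
finite-dimensional. -/
def IsAdmissibleRep {V : Type*} [AddCommGroup V] [Module ℂ V] (ρ : Representation ℂ G V) : Prop :=
  (∀ v : V, ∃ K : Subgroup G, IsOpen (K : Set G) ∧ ∀ k ∈ K, ρ k v = v) ∧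
  ∀ K : Subgroup G, IsOpen (K : Set G) →
    FiniteDimensional ℂ (Representation.invariants (ρ.comp K.subtype))

end Induction

/-! ### The quadratic extension, the quaternion algebra and their filtrations -/

namespace UTwo

variable {F : Type*} [Field F] [ValuativeRel F]

/-- `E = F(α)` with `α ^ 2 = z`; `star` is the conjugation of `E/F`. -/
abbrev E (z : 𝒪[F]) : Type _ := QuadraticAlgebra F (z : F) 0

/-- The cyclic algebra `D = (E/F, τ, ϖ) = E ⊕ E δ`, with `F`-basis `1, α, δ, α δ`, where
`α ^ 2 = z`, `δ ^ 2 = ϖ` and `δ α = - α δ`; `star` is the canonical involution of `D`. -/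
abbrev D (z ϖ : 𝒪[F]) : Type _ := ℍ[F, (z : F), 0, (ϖ : F)]

/-- The group `E¹` of norm-one elements of `E`. -/
abbrev E1 (z : 𝒪[F]) : Type _ := unitary (E z)

/-- The group `D¹` of elements of `D` of reduced norm one. -/
abbrev D1 (z ϖ : 𝒪[F]) : Type _ := unitary (D z ϖ)

variable {z ϖ : 𝒪[F]}

theorem E.re_one : (1 : E z).re = 1 := rfl

theorem E.im_one : (1 : E z).im = 0 := rfl

theorem star_algebraMap (t : 𝒪[F]) : star (algebraMap 𝒪[F] (E z) t) = algebraMap 𝒪[F] (E z) t := by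
  have : algebraMap 𝒪[F] (E z) t = ⟨(t : F), 0⟩ := rfl
  rw [this]; ext <;> simp

/-- The reduced norm `x ↦ x * τ_D(x)` of `D`, an element of `F`. -/
def nrd (x : D z ϖ) : F := (x * star x).re

/-- The reduced trace `x ↦ x + τ_D(x)` of `D`, an element of `F`. -/
def trd (x : D z ϖ) : F := (x + star x).re

/-- `v_D(x) = k`, where `v_D = v_F ∘ N_{D/F}` (so that `v_D(δ) = 1`). -/
def HasValD (x : D z ϖ) (k : ℤ) : Prop :=
  ValuativeRel.valuation F (nrd x) = ValuativeRel.valuation F (ϖ : F) ^ k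

/-- The embedding of `E` in `D`. -/
def ofE : E z →+* D z ϖ where
  toFun a := ⟨a.re, a.im, 0, 0⟩
  map_one' := by ext <;> simp [E.re_one, E.im_one]
  map_mul' a b := by ext <;> simp
  map_zero' := by ext <;> simp
  map_add' a b := by ext <;> simp

theorem ofE_star (a : E z) : (ofE (star a) : D z ϖ) = star (ofE a) := by
  ext <;> simp [ofE]

/-- The uniformizer `δ` of `D`. -/
def δ : D z ϖ := ⟨0, 0, 1, 0⟩

/-- The component `a` of `x = a + c δ`, with `a, c` in `E`. -/
def fstE (x : D z ϖ) : E z := ⟨x.re, x.imI⟩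

/-- The component `c` of `x = a + c δ`, with `a, c` in `E`. -/
def sndE (x : D z ϖ) : E z := ⟨x.imJ, x.imK⟩

theorem eq_fstE_add_sndE (x : D z ϖ) : x = ofE (fstE x) + ofE (sndE x) * δ := by
  ext <;> simp [ofE, δ, fstE, sndE]

theorem fstE_mul (x y : D z ϖ) :
    fstE (x * y) = fstE x * fstE y + algebraMap 𝒪[F] (E z) ϖ * (sndE x * star (sndE y)) := by
  have : algebraMap 𝒪[F] (E z) ϖ = ⟨(ϖ : F), 0⟩ := rfl
  rw [this]
  ext <;> simp [fstE, sndE] <;> ring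

theorem sndE_mul (x y : D z ϖ) :
    sndE (x * y) = fstE x * sndE y + sndE x * star (fstE y) := by
  ext <;> simp [fstE, sndE] <;> ring

/-- The ring of integers `O_E`. -/
def OE (z : 𝒪[F]) : Subalgebra 𝒪[F] (E z) := integralClosure 𝒪[F] (E z)

theorem star_mem_OE {a : E z} (h : a ∈ OE z) : star a ∈ OE z := by
  let s : E z →ₐ[𝒪[F]] E z :=
    { toFun := star
      map_one' := star_one _
      map_mul' := fun a b => by rw [star_mul, mul_comm]
      map_zero' := star_zero _
      map_add' := star_add
      commutes' := fun r => by
        have : algebraMap 𝒪[F] (E z) r = ⟨(r : F), 0⟩ := rfl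
        rw [this]; ext <;> simp }
  exact IsIntegral.map s h

/-- The ring of integers `O_D = O_E + O_E δ`. -/
def OD (z ϖ : 𝒪[F]) : Subring (D z ϖ) where
  carrier := {x | fstE x ∈ OE z ∧ sndE x ∈ OE z}
  one_mem' := ⟨by convert (OE z).one_mem; ext <;> simp [fstE, E.re_one, E.im_one],
    by convert (OE z).zero_mem; ext <;> simp [sndE]⟩
  zero_mem' := ⟨by convert (OE z).zero_mem; ext <;> simp [fstE],
    by convert (OE z).zero_mem; ext <;> simp [sndE]⟩
  mul_mem' := by
    rintro x y ⟨hx, hx'⟩ ⟨hy, hy'⟩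
    refine ⟨?_, ?_⟩
    · rw [fstE_mul]
      exact add_mem (mul_mem hx hy)
        (mul_mem ((OE z).algebraMap_mem ϖ) (mul_mem hx' (star_mem_OE hy')))
    · rw [sndE_mul]
      exact add_mem (mul_mem hx hy') (mul_mem hx' (star_mem_OE hy))
  add_mem' := by
    rintro x y ⟨hx, hx'⟩ ⟨hy, hy'⟩
    refine ⟨?_, ?_⟩
    · convert add_mem hx hy; ext <;> simp [fstE]
    · convert add_mem hx' hy'; ext <;> simp [sndE]
  neg_mem' := by
    rintro x ⟨hx, hx'⟩
    refine ⟨?_, ?_⟩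
    · convert neg_mem hx; ext <;> simp [fstE]
    · convert neg_mem hx'; ext <;> simp [sndE]

theorem δ_mem_OD : (δ : D z ϖ) ∈ OD z ϖ :=
  ⟨by convert (OE z).zero_mem; ext <;> simp [fstE, δ],
    by convert (OE z).one_mem; ext <;> simp [sndE, δ, E.re_one, E.im_one]⟩

theorem star_mem_OD {x : D z ϖ} (hx : x ∈ OD z ϖ) : star x ∈ OD z ϖ := by
  refine ⟨?_, ?_⟩
  · convert star_mem_OE hx.1; ext <;> simp [fstE]
  · convert neg_mem hx.2; ext <;> simp [sndE]

theorem δ_pow_mul (r : ℕ) {x : D z ϖ} (hx : x ∈ OD z ϖ) :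
    ∃ y ∈ OD z ϖ, δ ^ r * x = y * δ ^ r := by
  induction r generalizing x with
  | zero => exact ⟨x, hx, by simp⟩
  | succ r ih =>
    have : (δ : D z ϖ) * x = (ofE (star (fstE x)) + ofE (star (sndE x)) * δ) * δ := by
      ext <;> simp [ofE, δ, fstE, sndE]
    obtain ⟨y, hy, e⟩ := ih (x := ofE (star (fstE x)) + ofE (star (sndE x)) * δ) ⟨by
      convert star_mem_OE hx.1; ext <;> simp [ofE, δ, fstE, sndE], by
      convert star_mem_OE hx.2; ext <;> simp [ofE, δ, fstE, sndE]⟩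
    exact ⟨y, hy, by rw [pow_succ, mul_assoc, this, ← mul_assoc, e, mul_assoc]⟩

/-- `P_D^r = O_D δ^r`. -/
def PD (z ϖ : 𝒪[F]) (r : ℕ) : Set (D z ϖ) := {x | ∃ a ∈ OD z ϖ, x = a * δ ^ r}

/-- `D¹_r = {x ∈ D¹ : x - 1 ∈ P_D^r}`. -/
def D1r (z ϖ : 𝒪[F]) (r : ℕ) : Subgroup (D1 z ϖ) where
  carrier := {x | (x : D z ϖ) - 1 ∈ PD z ϖ r}
  one_mem' := ⟨0, zero_mem _, by simp⟩
  mul_mem' := by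
    rintro x y ⟨a, ha, hx⟩ ⟨b, hb, hy⟩
    refine ⟨a + b + a * δ ^ r * b,
      add_mem (add_mem ha hb) (mul_mem (mul_mem ha (pow_mem δ_mem_OD r)) hb), ?_⟩
    have : ((x * y : D1 z ϖ) : D z ϖ) - 1 =
        ((x : D z ϖ) - 1) + ((y : D z ϖ) - 1) + ((x : D z ϖ) - 1) * ((y : D z ϖ) - 1) := by
      rw [Submonoid.coe_mul]; noncomm_ring
    rw [this, hx, hy]; noncomm_ring
  inv_mem' := by
    rintro x ⟨a, ha, hx⟩
    obtain ⟨b, hb, e⟩ := δ_pow_mul r (star_mem_OD ha)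
    have hδ : star (δ : D z ϖ) = -δ := by ext <;> simp [δ]
    have : ((x⁻¹ : D1 z ϖ) : D z ϖ) - 1 = (-1) ^ r * b * δ ^ r := by
      have h1 : ((x⁻¹ : D1 z ϖ) : D z ϖ) - 1 = star ((x : D z ϖ) - 1) := by
        rw [star_sub, star_one]; rfl
      rw [h1, hx, star_mul, star_pow, hδ, neg_pow, mul_assoc, e, mul_assoc]
    exact ⟨(-1) ^ r * b, mul_mem (pow_mem (neg_mem (one_mem _)) r) hb, this⟩

/-- The embedding `E¹ → D¹`. -/
def torus : E1 z →* D1 z ϖ where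
  toFun l := ⟨ofE (l : E z), by
    rw [Unitary.mem_iff, ← ofE_star, ← map_mul, ← map_mul]
    simp⟩
  map_one' := by ext1; simp
  map_mul' a b := by ext1; simp

/-- The subgroup `E¹ D¹_r` of `D¹`. -/
def ED (z ϖ : 𝒪[F]) (r : ℕ) : Subgroup (D1 z ϖ) := torus.range ⊔ D1r z ϖ r

/-! ### The group `U(2)` -/

/-- The Gram matrix `diag(1, -δ²) = diag(1, -ϖ)` of the Hermitian form on `D = E ⊕ E δ`. -/
def gram (z ϖ : 𝒪[F]) : Matrix (Fin 2) (Fin 2) (E z) := !![1, 0; 0, -algebraMap 𝒪[F] (E z) ϖ]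

/-- `U(2) = {x ∈ GL₂(E) : x J (conjugate transpose of x) = J}` with `J = diag(1, -ϖ)`. -/
def U2 (z ϖ : 𝒪[F]) : Subgroup (GL (Fin 2) (E z)) where
  carrier := {x | (x : Matrix (Fin 2) (Fin 2) (E z)) * gram z ϖ *
    (x : Matrix (Fin 2) (Fin 2) (E z))ᴴ = gram z ϖ}
  one_mem' := by simp
  mul_mem' := by
    intro x y hx hy
    simp only [Set.mem_ofPred_eq] at hx hy ⊢
    rw [Units.val_mul, Matrix.conjTranspose_mul]
    calc _ = (x : Matrix (Fin 2) (Fin 2) (E z)) *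
          ((y : Matrix (Fin 2) (Fin 2) (E z)) * gram z ϖ *
            (y : Matrix (Fin 2) (Fin 2) (E z))ᴴ) * (x : Matrix (Fin 2) (Fin 2) (E z))ᴴ := by
          simp only [Matrix.mul_assoc]
      _ = _ := by rw [hy, hx]
  inv_mem' := by
    intro x hx
    simp only [Set.mem_ofPred_eq] at hx ⊢
    have h1 : ((x⁻¹ : GL (Fin 2) (E z)) : Matrix (Fin 2) (Fin 2) (E z)) *
        (x : Matrix (Fin 2) (Fin 2) (E z)) = 1 := by
      rw [← Units.val_mul]; simp
    have h2 : (x : Matrix (Fin 2) (Fin 2) (E z))ᴴ *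
        ((x⁻¹ : GL (Fin 2) (E z)) : Matrix (Fin 2) (Fin 2) (E z))ᴴ = 1 := by
      rw [← Matrix.conjTranspose_mul, h1, Matrix.conjTranspose_one]
    conv_lhs => rw [← hx]
    calc _ = (((x⁻¹ : GL (Fin 2) (E z)) : Matrix (Fin 2) (Fin 2) (E z)) *
          (x : Matrix (Fin 2) (Fin 2) (E z))) * gram z ϖ *
          ((x : Matrix (Fin 2) (Fin 2) (E z))ᴴ *
            ((x⁻¹ : GL (Fin 2) (E z)) : Matrix (Fin 2) (Fin 2) (E z))ᴴ) := by
          simp only [Matrix.mul_assoc]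
      _ = _ := by rw [h1, h2, Matrix.one_mul, Matrix.mul_one]

/-- The matrix of right multiplication by `x = a + c δ` on `D = E ⊕ E δ` (acting on rows). -/
def mat : D z ϖ →* Matrix (Fin 2) (Fin 2) (E z) where
  toFun x := !![fstE x, sndE x;
    algebraMap 𝒪[F] (E z) ϖ * star (sndE x), star (fstE x)]
  map_one' := by
    have h1 : fstE (1 : D z ϖ) = 1 := by ext <;> simp [fstE, E.re_one, E.im_one]
    have h2 : sndE (1 : D z ϖ) = 0 := by ext <;> simp [sndE]
    rw [h1, h2, Matrix.one_fin_two]; simp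
  map_mul' x y := by
    have h := star_algebraMap (z := z) ϖ
    rw [fstE_mul, sndE_mul, Matrix.mul_fin_two]
    simp only [star_add, star_mul', star_star, h]
    congr 1
    refine congrArg₂ _ (congrArg₂ _ ?_ (congrArg₂ _ ?_ rfl))
      (congrArg₂ _ (congrArg₂ _ ?_ (congrArg₂ _ ?_ rfl)) rfl) <;> ring

/-- The identification of `D¹` with `SU(2)`, as an embedding `D¹ → U(2)`. -/
def ι : D1 z ϖ →* U2 z ϖ where
  toFun x := ⟨⟨mat (x : D z ϖ), mat ((x⁻¹ : D1 z ϖ) : D z ϖ),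
      by rw [← map_mul, ← Submonoid.coe_mul]; simp,
      by rw [← map_mul, ← Submonoid.coe_mul]; simp⟩, by
    have hx : (x : D z ϖ) * star (x : D z ϖ) = 1 := Unitary.mul_star_self_of_mem x.2
    have h0 : ((x : D z ϖ) * star (x : D z ϖ)).re = 1 := by rw [hx]; rfl
    have h := star_algebraMap (z := z) ϖ
    have h1 : fstE (x : D z ϖ) * star (fstE (x : D z ϖ)) -
        algebraMap 𝒪[F] (E z) ϖ * (sndE (x : D z ϖ) * star (sndE (x : D z ϖ))) = 1 := by
      have : algebraMap 𝒪[F] (E z) ϖ = ⟨(ϖ : F), 0⟩ := rfl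
      rw [this]
      simp only [QuaternionAlgebra.re_mul, QuaternionAlgebra.re_star, QuaternionAlgebra.imI_star,
        QuaternionAlgebra.imJ_star, QuaternionAlgebra.imK_star] at h0
      ext
      · simp [fstE, sndE, E.re_one]; linear_combination h0
      · simp [fstE, sndE, E.im_one]; ring
    show mat (x : D z ϖ) * gram z ϖ * (mat (x : D z ϖ))ᴴ = gram z ϖ
    ext1 i j
    fin_cases i <;> fin_cases j <;>
      simp [mat, gram, Matrix.mul_apply, Fin.sum_univ_two, h]
    · linear_combination h1
    · ring
    · ring
    · linear_combination (-algebraMap 𝒪[F] (E z) ϖ) * h1⟩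
  map_one' := by ext1; ext1; simp
  map_mul' x y := by ext1; ext1; simp

/-- The embedding `λ ↦ diag(1, λ)` of `E¹` in `U(2)`. -/
def diagE : E1 z →* U2 z ϖ where
  toFun l := ⟨⟨!![1, 0; 0, (l : E z)], !![1, 0; 0, star (l : E z)],
      by rw [Matrix.mul_fin_two, Matrix.one_fin_two]; simp,
      by rw [Matrix.mul_fin_two, Matrix.one_fin_two]; simp⟩, by
    have hl : (l : E z) * star (l : E z) = 1 := Unitary.mul_star_self_of_mem l.2
    show !![1, 0; 0, (l : E z)] * gram z ϖ * (!![1, 0; 0, (l : E z)])ᴴ = gram z ϖ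
    ext1 i j
    fin_cases i <;> fin_cases j <;>
      simp [gram, Matrix.mul_apply, Fin.sum_univ_two]
    linear_combination (algebraMap 𝒪[F] (E z) ϖ) * hl⟩
  map_one' := by ext1; ext1; simp [Matrix.one_fin_two]
  map_mul' a b := by
    ext1; ext1
    simp

/-- The subgroup `E¹ D¹_r ⋊ E¹` of `U(2) = D¹ ⋊ E¹`. The pair `(g, l)` of the semidirect product
is the matrix `ι g * diagE l`. -/
def EDE (z ϖ : 𝒪[F]) (r : ℕ) : Subgroup (U2 z ϖ) := (ED z ϖ r).map ι ⊔ diagE.range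

/-! ### Characters -/

/-- `ψ` is a nontrivial additive character of `F` of conductor `P_F`. -/
def HasConductorP (ψ : AddChar F ℂ) : Prop :=
  (∀ x : F, ValuativeRel.valuation F x < 1 → ψ x = 1) ∧
  ∃ x : F, ValuativeRel.valuation F x ≤ 1 ∧ ψ x ≠ 1

/-- `ψ_β(h) = ψ(Tr(β (h - 1)))`. -/
def psiB (ψ : AddChar F ℂ) (β : D z ϖ) (h : D1 z ϖ) : ℂ := ψ (trd (β * ((h : D z ϖ) - 1)))

/-- `γ ∈ Λ_β`: `γ` agrees with `ψ_β` on `E¹ ∩ D¹_r`. -/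
def MemLambda (ψ : AddChar F ℂ) (β : D z ϖ) (r : ℕ) (γ : E1 z →* ℂˣ) : Prop :=
  ∀ l : E1 z, torus l ∈ D1r z ϖ r → (γ l : ℂ) = psiB ψ β (torus l)

/-- `χ` is the character `γ_{(β, ζ)}`, given by `(l x, l') ↦ γ(l) ψ_β(x) ζ(l')` for `l, l'` in `E¹`
and `x` in `D¹_r`, on the subgroup `E¹ D¹_s ⋊ E¹` of `U(2)`. -/
def IsGammaBetaZeta (ψ : AddChar F ℂ) (β : D z ϖ) (r : ℕ) (γ ζ : E1 z →* ℂˣ) (s : ℕ)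
    (χ : EDE z ϖ s →* ℂˣ) : Prop :=
  ∀ (l l' : E1 z) (x : D1 z ϖ), x ∈ D1r z ϖ r → ∀ h : EDE z ϖ s,
    (h : U2 z ϖ) = ι (torus l * x) * diagE l' → (χ h : ℂ) = γ l * psiB ψ β x * ζ l'

end UTwo

end

open UTwo

/-!
The proof rests on two facts: the norm of `E` is anisotropic modulo `P_F`, because `z` is a unit
that is not a square, and `N(a)`, `ϖ N(c)` have valuations of different parities. Hence norm-one
elements of `D` are integral (`absE_le_one_of_norm_sub_le_one`), `U(2)` is compact
(`compactSpace_U2`), and a norm-one element `a + c δ` with `c` divisible by `ϖ ^ k` has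
`N(a) ≡ 1` modulo `ϖ ^ (2 k + 1)`. By Hensel's lemma `N(a)` is then a square, and dividing by
`a / √N(a) ∈ E¹` shows that the element lies in `E¹ D¹_{2k+1}` (`exists_torus_mul_of_sndE_le`).
As `m = 2 k` is even, this is the equality `E¹ D¹_m = E¹ D¹_{m+1}`.

Consequently every element of `E¹ D¹_m ⋊ E¹` has the form `(λ x, λ')` with `x ∈ D¹_{m+1}`. The
function `γ(λ) ψ_β(x) ζ(λ')` is well defined since `γ = ψ_β` on `E¹ ∩ D¹_{m+1}`, and
multiplicative if `β` lies in `E`, since `ψ_β` then depends only on the component in `E`.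

As `U(2)` is compact, the induced representation is admissible, and it is irreducible once only
the elements of `E¹ D¹_m ⋊ E¹` intertwine the character (`isIrreducible_cInd`): averaging a nonzero
vector of a subrepresentation over the subgroup yields a multiple of the function supported on the
subgroup, whose translates span. For the intertwining, testing `ψ_{β'}` on Cayley transforms shows
that `ψ_{β'} = 1` on `D¹_{2k+1}` forces `β' ∈ ϖ^{-k} O_D` when `β'` has trace zero
(`absE_le_of_psiB_eq_one`). Taking `β' = x β x⁻¹ - β` with `x = (1 + α) / (1 - α)` in `E¹`, which
intertwines as it lies in the subgroup on which the character is defined, shows that `β` lies in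
`E` modulo `ϖ^{-k} O_D`; taking then an arbitrary intertwining `x = u + d δ` shows that `d` is
divisible by `ϖ ^ k`, so that `x` lies in `E¹ D¹_m` (`mem_ED_of_intertwines`).
-/

noncomputable section

/-! ### Compact induction from an open subgroup of a compact group -/

section CompactGroup

variable {G : Type*} [Group G] [TopologicalSpace G]

theorem cInd_apply [IsTopologicalGroup G] {H : Subgroup G} {χ : H →* ℂˣ} (x : G)
    (f : cIndSpace H χ) (g : G) :
    (cInd H χ x f : G → ℂ) g = (f : G → ℂ) (g * x) := rfl

/-- The function of `Ind(G, H; χ)` that is supported on `H` and extends `χ`. The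
open subgroup `K`, on which `χ` is trivial, serves only to show that this function is smooth. -/
def extendByZero (H : Subgroup G) (χ : H →* ℂˣ) (K : Subgroup G) (hK : IsOpen (K : Set G))
    (hKH : K ≤ H) (hχ : ∀ k (hk : k ∈ K), χ ⟨k, hKH hk⟩ = 1) : cIndSpace H χ := by
  classical
  refine ⟨fun g => if h : g ∈ H then χ ⟨g, h⟩ else 0, fun h g => ?_, ⟨K, hK, fun g k hk => ?_⟩,
    {1}, isCompact_singleton, fun g hg => ?_⟩
  · dsimp only
    by_cases hg : g ∈ H
    · rw [dif_pos (mul_mem h.2 hg), dif_pos hg, ← Units.val_mul, ← map_mul]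
      rfl
    · rw [dif_neg (fun h' => hg ((H.mul_mem_cancel_left h.2).1 h')), dif_neg hg, mul_zero]
  · dsimp only
    by_cases hg : g ∈ H
    · rw [dif_pos (mul_mem hg (hKH hk)), dif_pos hg]
      have : (⟨g * k, mul_mem hg (hKH hk)⟩ : H) = ⟨g, hg⟩ * ⟨k, hKH hk⟩ := rfl
      rw [this, map_mul, hχ k hk, mul_one]
    · rw [dif_neg (fun h' => hg ((H.mul_mem_cancel_right (hKH hk)).1 h')), dif_neg hg]
  · by_cases h : g ∈ H
    · exact ⟨g, h, 1, rfl, by simp⟩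
    · exact (hg (dif_neg h)).elim

theorem extendByZero_of_mem {H : Subgroup G} {χ : H →* ℂˣ} {K : Subgroup G}
    (hK : IsOpen (K : Set G)) (hKH : K ≤ H) (hχ : ∀ k (hk : k ∈ K), χ ⟨k, hKH hk⟩ = 1)
    {g : G} (hg : g ∈ H) :
    (extendByZero H χ K hK hKH hχ : G → ℂ) g = χ ⟨g, hg⟩ := dif_pos hg

theorem extendByZero_of_notMem {H : Subgroup G} {χ : H →* ℂˣ} {K : Subgroup G}
    (hK : IsOpen (K : Set G)) (hKH : K ≤ H) (hχ : ∀ k (hk : k ∈ K), χ ⟨k, hKH hk⟩ = 1)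
    {g : G} (hg : g ∉ H) :
    (extendByZero H χ K hK hKH hχ : G → ℂ) g = 0 := dif_neg hg

variable [IsTopologicalGroup G] [CompactSpace G]

/-- A function fixed by `K` is determined by its values on the finite set `G ⧸ K`. -/
theorem isAdmissibleRep_cInd (H : Subgroup G) (χ : H →* ℂˣ) : IsAdmissibleRep (cInd H χ) := by
  refine ⟨fun f => ?_, fun K hK => ?_⟩
  · obtain ⟨K, hK, hf⟩ := f.2.2.1
    exact ⟨K, hK, fun k hk => Subtype.ext (funext fun g => hf g k hk)⟩
  · have := K.quotient_finite_of_isOpen hK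
    let Φ : Representation.invariants ((cInd H χ).comp K.subtype) →ₗ[ℂ] (G ⧸ K → ℂ) :=
      { toFun := fun f q => ((f : cIndSpace H χ) : G → ℂ) q.out
        map_add' := fun _ _ => rfl
        map_smul' := fun _ _ => rfl }
    refine FiniteDimensional.of_injective Φ fun f f' h => ?_
    have key : ∀ (e : Representation.invariants ((cInd H χ).comp K.subtype)) (g : G),
        ((e : cIndSpace H χ) : G → ℂ) g =
          ((e : cIndSpace H χ) : G → ℂ) (g : G ⧸ K).out := by
      intro e g
      obtain ⟨k, hk⟩ := QuotientGroup.mk_out_eq_mul K g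
      rw [hk]
      have := congrArg (fun u : cIndSpace H χ => (u : G → ℂ) g) (e.2 k)
      exact this.symm
    refine Subtype.ext (Subtype.ext (funext fun g => ?_))
    rw [key f g, key f' g]
    exact congrFun h _

/-- The translates of the extension of `χ` by zero span the induced representation. -/
theorem eq_top_of_extendByZero_mem {H : Subgroup G} {χ : H →* ℂˣ} {K : Subgroup G}
    (hK : IsOpen (K : Set G)) (hKH : K ≤ H) (hχ : ∀ k (hk : k ∈ K), χ ⟨k, hKH hk⟩ = 1)
    (W : Subrepresentation (cInd H χ)) (hW : extendByZero H χ K hK hKH hχ ∈ W.toSubmodule)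
    (f : cIndSpace H χ) : f ∈ W.toSubmodule := by
  classical
  have := H.quotient_finite_of_isOpen (Subgroup.isOpen_mono hKH hK)
  have := Fintype.ofFinite (G ⧸ H)
  have hf : f = ∑ q : G ⧸ H, (f : G → ℂ) q.out⁻¹ •
      cInd H χ q.out (extendByZero H χ K hK hKH hχ) := by
    refine Subtype.ext (funext fun g => ?_)
    rw [AddSubmonoidClass.coe_finsetSum, Finset.sum_apply,
      Finset.sum_eq_single (QuotientGroup.mk g⁻¹ : G ⧸ H)]
    · obtain ⟨h, hh⟩ := QuotientGroup.mk_out_eq_mul H g⁻¹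
      rw [hh]
      have hm : g * (g⁻¹ * (h : G)) ∈ H := by simp
      have h1 := f.2.1 ⟨_, hm⟩ (g⁻¹ * (h : G))⁻¹
      rw [show g * (g⁻¹ * (h : G)) * (g⁻¹ * (h : G))⁻¹ = g by group] at h1
      simp only [SetLike.val_smul, Pi.smul_apply, smul_eq_mul, cInd_apply,
        extendByZero_of_mem hK hKH hχ hm]
      rw [h1, mul_comm]
    · intro q _ hq
      have hm : g * q.out ∉ H := fun h => hq (by
        rw [← q.out_eq']
        exact (QuotientGroup.eq.2 (by simpa using h)).symm)
      simp only [SetLike.val_smul, Pi.smul_apply, smul_eq_mul, cInd_apply,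
        extendByZero_of_notMem hK hKH hχ hm, mul_zero]
    · intro h
      exact (h (Finset.mem_univ _)).elim
  rw [hf]
  exact Submodule.sum_mem _ fun q _ => W.toSubmodule.smul_mem _ (W.apply_mem_toSubmodule _ hW)

/-- A nonzero subrepresentation contains the extension of `χ` by zero: averaging over `H` a
function of it that does not vanish at `1` gives a function that transforms by `χ` on both sides,
and the hypothesis `hM` confines the support of such a function to `H`. -/
theorem extendByZero_mem_of_ne_zero {H : Subgroup G} {χ : H →* ℂˣ} {K : Subgroup G}
    (hK : IsOpen (K : Set G)) (hKH : K ≤ H) (hχ : ∀ k (hk : k ∈ K), χ ⟨k, hKH hk⟩ = 1)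
    (hM : ∀ g ∉ H, ∃ h : H, ∃ hg : g⁻¹ * h * g ∈ H, χ h ≠ χ ⟨g⁻¹ * h * g, hg⟩)
    (W : Subrepresentation (cInd H χ)) (f : cIndSpace H χ) (hf : f ∈ W.toSubmodule)
    (hf1 : (f : G → ℂ) 1 ≠ 0) : extendByZero H χ K hK hKH hχ ∈ W.toSubmodule := by
  classical
  obtain ⟨L, hL, hfL⟩ := f.2.2.1
  have hKL : IsOpen ((K ⊓ L : Subgroup G) : Set G) := hK.inter hL
  have hfin := Subgroup.quotient_finite_of_isOpen _ hKL
  have : Finite (H ⧸ (K ⊓ L).subgroupOf H) := by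
    have : (K ⊓ L).FiniteIndex := Subgroup.finiteIndex_of_finite_quotient
    infer_instance
  have := Fintype.ofFinite (H ⧸ (K ⊓ L).subgroupOf H)
  -- the summand of the average; it depends on `h` only modulo `K ⊓ L`
  let φ : G → H → ℂ := fun g h => ((χ h)⁻¹ : ℂˣ) * (f : G → ℂ) (g * h)
  have hφ : ∀ g (h : H), φ g (QuotientGroup.mk h : H ⧸ (K ⊓ L).subgroupOf H).out = φ g h := by
    intro g h
    obtain ⟨k, hk⟩ := QuotientGroup.mk_out_eq_mul ((K ⊓ L).subgroupOf H) h
    have hk' : ((k : H) : G) ∈ K ⊓ L := k.2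
    have h1 : χ (k : H) = 1 := hχ _ hk'.1
    simp only [φ, hk, map_mul, h1, mul_one, Subgroup.coe_mul, ← mul_assoc, hfL _ _ hk'.2]
  let F : cIndSpace H χ := ∑ q : H ⧸ (K ⊓ L).subgroupOf H,
    (((χ q.out)⁻¹ : ℂˣ) : ℂ) • cInd H χ (q.out : H) f
  have hFW : F ∈ W.toSubmodule :=
    Submodule.sum_mem _ fun q _ => W.toSubmodule.smul_mem _ (W.apply_mem_toSubmodule _ hf)
  have hF : ∀ g, (F : G → ℂ) g = ∑ q : H ⧸ (K ⊓ L).subgroupOf H, φ g q.out := by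
    intro g
    simp only [F]
    rw [AddSubmonoidClass.coe_finsetSum, Finset.sum_apply]
    rfl
  have hFr : ∀ g (h : H), (F : G → ℂ) (g * h) = χ h * (F : G → ℂ) g := by
    intro g h
    have h1 : ∀ q : H ⧸ (K ⊓ L).subgroupOf H, φ (g * h) q.out = χ h * φ g (h • q).out := by
      intro q
      have : h • q = QuotientGroup.mk (h * q.out) := by
        conv_lhs => rw [← q.out_eq']
        rfl
      rw [this, hφ]
      simp only [φ, map_mul, Subgroup.coe_mul, mul_inv, Units.val_mul, ← mul_assoc,
        Units.mul_inv, one_mul]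
    rw [hF, hF, Finset.sum_congr rfl fun q _ => h1 q, ← Finset.mul_sum]
    exact congrArg _ (Equiv.sum_comp (MulAction.toPerm h)
      fun q : H ⧸ (K ⊓ L).subgroupOf H => φ g q.out)
  have hF1 : (F : G → ℂ) 1 = Fintype.card (H ⧸ (K ⊓ L).subgroupOf H) * (f : G → ℂ) 1 := by
    have : ∀ q : H ⧸ (K ⊓ L).subgroupOf H, φ 1 q.out = (f : G → ℂ) 1 := by
      intro q
      have := f.2.1 q.out 1
      rw [mul_one] at this
      simp only [φ, one_mul, this, ← mul_assoc, Units.inv_mul]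
    rw [hF, Finset.sum_congr rfl fun q _ => this q]
    simp
  have hF1' : (F : G → ℂ) 1 ≠ 0 := by
    rw [hF1]
    exact mul_ne_zero (by exact_mod_cast Fintype.card_ne_zero) hf1
  have hFe : F = (F : G → ℂ) 1 • extendByZero H χ K hK hKH hχ := by
    refine Subtype.ext (funext fun g => ?_)
    simp only [SetLike.val_smul, Pi.smul_apply, smul_eq_mul]
    by_cases hg : g ∈ H
    · rw [extendByZero_of_mem hK hKH hχ hg, mul_comm]
      simpa using F.2.1 ⟨g, hg⟩ 1
    · rw [extendByZero_of_notMem hK hKH hχ hg, mul_zero]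
      obtain ⟨h, hg', hne⟩ := hM g hg
      have h1 := F.2.1 h g
      have h2 := hFr g ⟨_, hg'⟩
      have e : g * (g⁻¹ * h * g) = h * g := by group
      simp only [e, h1] at h2
      have h3 : ((χ h : ℂ) - χ ⟨_, hg'⟩) * (F : G → ℂ) g = 0 := by
        rw [sub_mul, h2, sub_self]
      rcases mul_eq_zero.1 h3 with h4 | h4
      · exact (hne (Units.ext (sub_eq_zero.1 h4))).elim
      · exact h4
  have : extendByZero H χ K hK hKH hχ = ((F : G → ℂ) 1)⁻¹ • F := by
    rw [eq_inv_smul_iff₀ hF1', ← hFe]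
  rw [this]
  exact W.toSubmodule.smul_mem _ hFW

/-- Mackey's criterion for a character of an open subgroup of a compact group. -/
theorem isIrreducible_cInd {H : Subgroup G} {χ : H →* ℂˣ} {K : Subgroup G}
    (hK : IsOpen (K : Set G)) (hKH : K ≤ H) (hχ : ∀ k (hk : k ∈ K), χ ⟨k, hKH hk⟩ = 1)
    (hM : ∀ g ∉ H, ∃ h : H, ∃ hg : g⁻¹ * h * g ∈ H, χ h ≠ χ ⟨g⁻¹ * h * g, hg⟩) :
    (cInd H χ).IsIrreducible := by
  have h0 : (extendByZero H χ K hK hKH hχ : G → ℂ) 1 ≠ 0 := by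
    rw [extendByZero_of_mem hK hKH hχ H.one_mem]
    exact (χ _).ne_zero
  refine { exists_pair_ne := ⟨⊥, ⊤, fun h => ?_⟩, eq_bot_or_eq_top := fun W => ?_ }
  · have h1 : extendByZero H χ K hK hKH hχ ∈ (⊥ : Subrepresentation (cInd H χ)) := h ▸ trivial
    have h2 : extendByZero H χ K hK hKH hχ = 0 := h1
    exact h0 (by rw [h2]; rfl)
  · by_cases hW : ∃ f ∈ W.toSubmodule, f ≠ 0
    · right
      obtain ⟨f, hf, hne⟩ := hW
      obtain ⟨g, hg⟩ : ∃ g, (f : G → ℂ) g ≠ 0 := by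
        by_contra! h
        exact hne (Subtype.ext (funext h))
      have := extendByZero_mem_of_ne_zero hK hKH hχ hM W _ (W.apply_mem_toSubmodule g hf)
        (by rwa [cInd_apply, one_mul])
      exact SetLike.ext fun f' =>
        ⟨fun _ => trivial, fun _ => eq_top_of_extendByZero_mem hK hKH hχ W this f'⟩
    · left
      push Not at hW
      refine SetLike.ext fun f => ⟨fun h => hW f h, fun h => ?_⟩
      have : f = 0 := h
      rw [this]
      exact W.toSubmodule.zero_mem

end CompactGroup

namespace UTwo

open ValuativeRel (valuation ValueGroupWithZero)

variable {F : Type*} [Field F] [ValuativeRel F] {z ϖ : 𝒪[F]}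

/-! ### Valuations in `F` and in `E` -/

section Valuation

theorem isUnit_iff_valuation_eq_one {x : 𝒪[F]} : IsUnit x ↔ valuation F (x : F) = 1 :=
  (Valuation.integer.integers (valuation F)).isUnit_iff_valuation_eq_one

theorem mem_maximalIdeal_iff_valuation_lt_one {x : 𝒪[F]} :
    x ∈ 𝓂[F] ↔ valuation F (x : F) < 1 := by
  rw [IsLocalRing.mem_maximalIdeal, mem_nonunits_iff, isUnit_iff_valuation_eq_one]
  exact ⟨fun h => lt_of_le_of_ne x.2 h, fun h => h.ne⟩

theorem isUnit_two (hp : ringChar 𝓀[F] ≠ 2) : IsUnit (2 : 𝒪[F]) := by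
  by_contra h
  have h1 : (2 : 𝒪[F]) ∈ 𝓂[F] := h
  have h2 := (IsLocalRing.residue_eq_zero_iff _).2 h1
  rw [map_ofNat] at h2
  exact Ring.two_ne_zero hp h2

theorem valuation_two (hp : ringChar 𝓀[F] ≠ 2) : valuation F 2 = 1 :=
  isUnit_iff_valuation_eq_one.1 (isUnit_two hp)

theorem two_ne_zero_of_ringChar (hp : ringChar 𝓀[F] ≠ 2) : (2 : F) ≠ 0 := fun h => by
  have := valuation_two hp
  rw [h, map_zero] at this
  exact zero_ne_one this

theorem valuation_uniformizer_ne_zero (hϖ : Irreducible ϖ) : valuation F (ϖ : F) ≠ 0 := by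
  rw [Valuation.ne_zero_iff]
  exact fun h => hϖ.ne_zero (Subtype.ext h)

theorem valuation_uniformizer_lt_one (hϖ : Irreducible ϖ) : valuation F (ϖ : F) < 1 :=
  mem_maximalIdeal_iff_valuation_lt_one.1 hϖ.not_isUnit

variable [TopologicalSpace F] [IsNonarchimedeanLocalField F]

theorem valuation_lt_one_iff_le (hϖ : Irreducible ϖ) {x : F} :
    valuation F x < 1 ↔ valuation F x ≤ valuation F (ϖ : F) := by
  refine ⟨fun h => ?_, fun h => h.trans_lt (valuation_uniformizer_lt_one hϖ)⟩
  have h1 : (⟨x, h.le⟩ : 𝒪[F]) ∈ 𝓂[F] := mem_maximalIdeal_iff_valuation_lt_one.2 h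
  rw [hϖ.maximalIdeal_eq, Ideal.mem_span_singleton] at h1
  exact (Valuation.integer.integers (valuation F)).le_of_dvd h1

/-- The valuation of a uniformizer has odd order. -/
theorem valuation_sq_ne_uniformizer (hϖ : Irreducible ϖ) (x : F) :
    valuation F x ^ 2 ≠ valuation F (ϖ : F) := by
  intro h
  have hx : valuation F x < 1 := by
    by_contra! h1
    have := one_le_pow₀ (n := 2) h1
    rw [h] at this
    exact this.not_gt (valuation_uniformizer_lt_one hϖ)
  have hx' := pow_le_pow_left' ((valuation_lt_one_iff_le hϖ).1 hx) 2
  rw [h, pow_two] at hx'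
  have h0 := valuation_uniformizer_ne_zero hϖ
  have := mul_lt_mul_of_pos_left (valuation_uniformizer_lt_one hϖ) (zero_lt_iff.2 h0)
  rw [mul_one] at this
  exact hx'.not_gt this

theorem exists_sq_eq_of_sub_sq_mem (hp : ringChar 𝓀[F] ≠ 2) {u t : 𝒪[F]} (ht : IsUnit t)
    (h : u - t ^ 2 ∈ 𝓂[F]) : ∃ s : 𝒪[F], s ^ 2 = u ∧ s - t ∈ 𝓂[F] := by
  let := IsTopologicalAddGroup.rightUniformSpace F
  have := isUniformAddGroup_of_addCommGroup (G := F)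
  obtain ⟨s, hs, hst⟩ := HenselianRing.is_henselian (I := 𝓂[F])
    (Polynomial.X ^ 2 - Polynomial.C u) (Polynomial.monic_X_pow_sub_C u two_ne_zero) t
    (by simpa using neg_mem h) (by
      refine IsUnit.map _ ?_
      simpa [one_add_one_eq_two] using (isUnit_two hp).mul ht)
  refine ⟨s, ?_, hst⟩
  simpa [sub_eq_zero] using hs

theorem valuation_sq_sub_eq_one (hp : ringChar 𝓀[F] ≠ 2) (hz : IsUnit z)
    (hz' : ¬ IsSquare (z : F)) {t : F} (ht : valuation F t ≤ 1) :
    valuation F (t ^ 2 - z) = 1 := by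
  by_contra hne
  have hm : (⟨t, ht⟩ ^ 2 - z : 𝒪[F]) ∈ 𝓂[F] := fun h =>
    hne (isUnit_iff_valuation_eq_one.1 h)
  have hu : IsUnit (⟨t, ht⟩ : 𝒪[F]) := by
    by_contra h
    have h1 : (⟨t, ht⟩ : 𝒪[F]) ∈ 𝓂[F] := h
    have h2 := sub_mem (Ideal.pow_mem_of_mem _ h1 2 two_pos) hm
    rw [sub_sub_cancel] at h2
    exact h2 hz
  obtain ⟨s, hs, -⟩ := exists_sq_eq_of_sub_sq_mem hp hu (by simpa using neg_mem hm)
  exact hz' ⟨s, by rw [← pow_two, ← hs]; rfl⟩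

theorem valuation_one_sub_mul_sq_eq_one (hp : ringChar 𝓀[F] ≠ 2) (hz : IsUnit z)
    (hz' : ¬ IsSquare (z : F)) {t : F} (ht : valuation F t ≤ 1) :
    valuation F (1 - z * t ^ 2) = 1 := by
  rcases ht.lt_or_eq with h | h
  · have h2 : valuation F (z * t ^ 2) < 1 := by
      rw [map_mul, isUnit_iff_valuation_eq_one.1 hz, one_mul, map_pow]
      exact pow_lt_one₀ zero_le h two_ne_zero
    exact Valuation.map_one_sub_of_lt _ h2
  · have h0 : t ≠ 0 := fun h0 => by simp [h0] at h
    have h1 := valuation_sq_sub_eq_one hp hz hz' (t := t⁻¹) (by simp [h])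
    have : 1 - z * t ^ 2 = t ^ 2 * (t⁻¹ ^ 2 - z) := by field_simp
    rw [this, map_mul, h1, map_pow, h]
    simp

end Valuation

section AbsoluteValue

/-- The valuation on `E`, with values in the value group of `F`: as `α` is a unit that is not
congruent to an element of `F`, it is the maximum of the valuations of the coordinates. -/
def absE (a : E z) : ValueGroupWithZero F := max (valuation F a.re) (valuation F a.im)

theorem absE_le_iff {a : E z} {g : ValueGroupWithZero F} :
    absE a ≤ g ↔ valuation F a.re ≤ g ∧ valuation F a.im ≤ g := max_le_iff

theorem exists_valuation_eq_absE (a : E z) : ∃ t : F, absE a = valuation F t := by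
  rcases max_choice (valuation F a.re) (valuation F a.im) with h | h
  exacts [⟨_, h⟩, ⟨_, h⟩]

@[simp] theorem absE_zero : absE (0 : E z) = 0 := by simp [absE]

@[simp] theorem absE_one : absE (1 : E z) = 1 := by simp [absE, E.re_one, E.im_one]

@[simp] theorem absE_star (a : E z) : absE (star a) = absE a := by
  simp [absE, Valuation.map_neg]

@[simp] theorem absE_algebraMap (t : 𝒪[F]) :
    absE (algebraMap 𝒪[F] (E z) t) = valuation F (t : F) := by
  have : algebraMap 𝒪[F] (E z) t = ⟨(t : F), 0⟩ := rfl
  simp [this, absE]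

@[simp] theorem absE_neg (a : E z) : absE (-a) = absE a := by
  simp [absE, Valuation.map_neg]

theorem absE_add_le {a b : E z} {g : ValueGroupWithZero F} (ha : absE a ≤ g) (hb : absE b ≤ g) :
    absE (a + b) ≤ g := by
  rw [absE_le_iff] at *
  exact ⟨Valuation.map_add_le _ ha.1 hb.1, Valuation.map_add_le _ ha.2 hb.2⟩

theorem absE_sub_le {a b : E z} {g : ValueGroupWithZero F} (ha : absE a ≤ g) (hb : absE b ≤ g) :
    absE (a - b) ≤ g := by
  rw [sub_eq_add_neg]
  exact absE_add_le ha (by rwa [absE_neg])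

theorem normE_eq (a : E z) : a.norm = a.re ^ 2 - z * a.im ^ 2 := by
  rw [QuadraticAlgebra.norm_def]; ring

theorem mul_star_eq_algebraMap_norm (a : E z) : a * star a = algebraMap F (E z) a.norm :=
  (QuadraticAlgebra.algebraMap_norm_eq_mul_star a).symm

variable [TopologicalSpace F] [IsNonarchimedeanLocalField F]

theorem valuation_norm (hp : ringChar 𝓀[F] ≠ 2) (hz : IsUnit z) (hz' : ¬ IsSquare (z : F))
    (a : E z) : valuation F a.norm = absE a ^ 2 := by
  rw [normE_eq, absE]
  rcases le_total (valuation F a.im) (valuation F a.re) with h | h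
  · rw [max_eq_left h]
    by_cases h0 : a.re = 0
    · have : a.im = 0 := by simpa [h0] using h
      simp [h0, this]
    · have : a.re ^ 2 - z * a.im ^ 2 = a.re ^ 2 * (1 - z * (a.im / a.re) ^ 2) := by field_simp
      rw [this, map_mul, valuation_one_sub_mul_sq_eq_one hp hz hz', mul_one, map_pow]
      rw [map_div₀]
      exact div_le_one_of_le₀ h zero_le
  · rw [max_eq_right h]
    by_cases h0 : a.im = 0
    · have : a.re = 0 := by simpa [h0] using h
      simp [h0, this]
    · have : a.re ^ 2 - z * a.im ^ 2 = a.im ^ 2 * ((a.re / a.im) ^ 2 - z) := by field_simp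
      rw [this, map_mul, valuation_sq_sub_eq_one hp hz hz', mul_one, map_pow]
      rw [map_div₀]
      exact div_le_one_of_le₀ h zero_le

theorem absE_mul (hp : ringChar 𝓀[F] ≠ 2) (hz : IsUnit z) (hz' : ¬ IsSquare (z : F))
    (a b : E z) : absE (a * b) = absE a * absE b := by
  refine (pow_left_inj₀ zero_le zero_le two_ne_zero).1 ?_
  rw [mul_pow, ← valuation_norm hp hz hz', ← valuation_norm hp hz hz',
    ← valuation_norm hp hz hz', map_mul, map_mul]

theorem absE_eq_one_of_norm (hp : ringChar 𝓀[F] ≠ 2) (hz : IsUnit z) (hz' : ¬ IsSquare (z : F))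
    (l : E1 z) : absE (l : E z) = 1 := by
  have h := valuation_norm hp hz hz' (l : E z)
  rw [QuadraticAlgebra.norm_eq_one_iff_mem_unitary.2 l.2, map_one] at h
  exact ((pow_eq_one_iff_of_nonneg zero_le two_ne_zero).1 h.symm)

theorem mem_OE_iff (hp : ringChar 𝓀[F] ≠ 2) (hz : IsUnit z) (hz' : ¬ IsSquare (z : F))
    {a : E z} : a ∈ OE z ↔ absE a ≤ 1 := by
  constructor
  · intro h
    have h1 : a * star a ∈ OE z := mul_mem h (star_mem_OE h)
    rw [mul_star_eq_algebraMap_norm] at h1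
    have h2 : IsIntegral 𝒪[F] a.norm :=
      (isIntegral_algebraMap_iff (algebraMap F (E z)).injective).1 h1
    have h3 : a.norm ∈ 𝒪[F] := by
      obtain ⟨t, ht⟩ := IsIntegrallyClosed.isIntegral_iff.1 h2
      rw [← ht]
      exact t.2
    have h4 : valuation F a.norm ≤ 1 := h3
    rw [valuation_norm hp hz hz'] at h4
    exact (pow_le_one_iff_of_nonneg zero_le two_ne_zero).1 h4
  · intro h
    rw [absE_le_iff] at h
    have hω : (⟨0, 1⟩ : E z) ∈ OE z := by
      refine ⟨Polynomial.X ^ 2 - Polynomial.C z, Polynomial.monic_X_pow_sub_C z two_ne_zero, ?_⟩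
      have : algebraMap 𝒪[F] (E z) z = ⟨(z : F), 0⟩ := rfl
      simp only [Polynomial.eval₂_sub, Polynomial.eval₂_C, this, pow_two]
      ext <;> simp
    have e : a = algebraMap 𝒪[F] (E z) ⟨a.re, h.1⟩ +
        algebraMap 𝒪[F] (E z) ⟨a.im, h.2⟩ * ⟨0, 1⟩ := by
      have h1 : algebraMap 𝒪[F] (E z) ⟨a.re, h.1⟩ = ⟨a.re, 0⟩ := rfl
      have h2 : algebraMap 𝒪[F] (E z) ⟨a.im, h.2⟩ = ⟨a.im, 0⟩ := rfl
      rw [h1, h2]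
      ext <;> simp
    rw [e]
    exact add_mem ((OE z).algebraMap_mem _) (mul_mem ((OE z).algebraMap_mem _) hω)

end AbsoluteValue

/-! ### The filtration of `D¹` -/

section Components

theorem D.ext_components {x y : D z ϖ} (h1 : fstE x = fstE y) (h2 : sndE x = sndE y) : x = y := by
  rw [eq_fstE_add_sndE x, eq_fstE_add_sndE y, h1, h2]

@[simp] theorem fstE_one : fstE (1 : D z ϖ) = 1 := by
  ext <;> simp [fstE, E.re_one, E.im_one]

@[simp] theorem sndE_one : sndE (1 : D z ϖ) = 0 := by
  ext <;> simp [sndE]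

@[simp] theorem fstE_add (x y : D z ϖ) : fstE (x + y) = fstE x + fstE y := by
  ext <;> simp [fstE]

@[simp] theorem sndE_add (x y : D z ϖ) : sndE (x + y) = sndE x + sndE y := by
  ext <;> simp [sndE]

@[simp] theorem fstE_sub (x y : D z ϖ) : fstE (x - y) = fstE x - fstE y := by
  ext <;> simp [fstE]

@[simp] theorem sndE_sub (x y : D z ϖ) : sndE (x - y) = sndE x - sndE y := by
  ext <;> simp [sndE]

@[simp] theorem fstE_star (x : D z ϖ) : fstE (star x) = star (fstE x) := by
  ext <;> simp [fstE]

@[simp] theorem sndE_star (x : D z ϖ) : sndE (star x) = -sndE x := by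
  ext <;> simp [sndE]

@[simp] theorem fstE_ofE (a : E z) : fstE (ofE a : D z ϖ) = a := by
  ext <;> simp [fstE, ofE]

@[simp] theorem sndE_ofE (a : E z) : sndE (ofE a : D z ϖ) = 0 := by
  ext <;> simp [sndE, ofE]

/-- The element `a + c δ` of `D`. -/
def mkD (a c : E z) : D z ϖ := ⟨a.re, a.im, c.re, c.im⟩

@[simp] theorem fstE_mkD (a c : E z) : fstE (mkD a c : D z ϖ) = a := rfl

@[simp] theorem sndE_mkD (a c : E z) : sndE (mkD a c : D z ϖ) = c := rfl

@[simp] theorem coe_torus (l : E1 z) : ((torus l : D1 z ϖ) : D z ϖ) = ofE (l : E z) := rfl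

@[simp] theorem coe_inv_D1 (x : D1 z ϖ) : ((x⁻¹ : D1 z ϖ) : D z ϖ) = star (x : D z ϖ) := rfl

theorem nrd_eq (x : D z ϖ) : nrd x = (fstE x).norm - ϖ * (sndE x).norm := by
  rw [normE_eq, normE_eq]
  simp [nrd, fstE, sndE]
  ring

theorem self_mul_star_eq_nrd (x : D z ϖ) : x * star x = algebraMap F (D z ϖ) (nrd x) := by
  rw [nrd, QuaternionAlgebra.coe_algebraMap]
  ext <;> simp <;> ring

theorem star_mul_self_eq_nrd (x : D z ϖ) : star x * x = algebraMap F (D z ϖ) (nrd x) := by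
  rw [nrd, QuaternionAlgebra.coe_algebraMap]
  ext <;> simp <;> ring

theorem mem_D1_iff {x : D z ϖ} : x ∈ unitary (D z ϖ) ↔ nrd x = 1 := by
  rw [Unitary.mem_iff, self_mul_star_eq_nrd, star_mul_self_eq_nrd, and_self]
  constructor
  · intro h
    have := congrArg QuaternionAlgebra.re h
    simpa [QuaternionAlgebra.coe_algebraMap] using this
  · intro h
    rw [h, map_one]

theorem nrd_D1 (x : D1 z ϖ) :
    (fstE (x : D z ϖ)).norm - ϖ * (sndE (x : D z ϖ)).norm = 1 := by
  rw [← nrd_eq, mem_D1_iff.1 x.2]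

theorem fstE_mul_δ (x : D z ϖ) : fstE (x * δ) = algebraMap 𝒪[F] (E z) ϖ * sndE x := by
  have : algebraMap 𝒪[F] (E z) ϖ = ⟨(ϖ : F), 0⟩ := rfl
  rw [this]
  ext <;> simp [fstE, sndE, δ]

theorem sndE_mul_δ (x : D z ϖ) : sndE (x * δ) = fstE x := by
  ext <;> simp [fstE, sndE, δ]

theorem mem_PD_zero {x : D z ϖ} : x ∈ PD z ϖ 0 ↔ x ∈ OD z ϖ := by simp [PD]

theorem mem_PD_succ {x : D z ϖ} {r : ℕ} : x ∈ PD z ϖ (r + 1) ↔ ∃ y ∈ PD z ϖ r, x = y * δ := by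
  constructor
  · rintro ⟨a, ha, rfl⟩
    exact ⟨a * δ ^ r, ⟨a, ha, rfl⟩, by rw [pow_succ, mul_assoc]⟩
  · rintro ⟨y, ⟨a, ha, rfl⟩, rfl⟩
    exact ⟨a, ha, by rw [pow_succ, mul_assoc]⟩

theorem PD_mul_right {r : ℕ} {x y : D z ϖ} (hx : x ∈ PD z ϖ r) (hy : y ∈ OD z ϖ) :
    x * y ∈ PD z ϖ r := by
  obtain ⟨a, ha, rfl⟩ := hx
  obtain ⟨b, hb, e⟩ := δ_pow_mul r hy
  exact ⟨a * b, mul_mem ha hb, by rw [mul_assoc, e, mul_assoc]⟩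

theorem PD_mul_left {r : ℕ} {x y : D z ϖ} (hx : x ∈ PD z ϖ r) (hy : y ∈ OD z ϖ) :
    y * x ∈ PD z ϖ r := by
  obtain ⟨a, ha, rfl⟩ := hx
  exact ⟨y * a, mul_mem hy ha, by rw [mul_assoc]⟩

theorem PD_mul {r s : ℕ} {x y : D z ϖ} (hx : x ∈ PD z ϖ r) (hy : y ∈ PD z ϖ s) :
    x * y ∈ PD z ϖ (r + s) := by
  obtain ⟨a, ha, rfl⟩ := hx
  obtain ⟨b, hb, rfl⟩ := hy
  obtain ⟨c, hc, e⟩ := δ_pow_mul r hb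
  exact ⟨a * c, mul_mem ha hc, by rw [mul_assoc, ← mul_assoc _ b, e, pow_add]; noncomm_ring⟩

theorem PD_succ_subset {r : ℕ} : PD z ϖ (r + 1) ⊆ PD z ϖ r := by
  intro x hx
  obtain ⟨y, hy, rfl⟩ := mem_PD_succ.1 hx
  exact PD_mul_right hy δ_mem_OD

theorem mem_D1r {r : ℕ} {x : D1 z ϖ} : x ∈ D1r z ϖ r ↔ (x : D z ϖ) - 1 ∈ PD z ϖ r := Iff.rfl

theorem D1r_succ_le {r : ℕ} : D1r z ϖ (r + 1) ≤ D1r z ϖ r := fun _ hx => PD_succ_subset hx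

end Components

section Filtration

variable [TopologicalSpace F] [IsNonarchimedeanLocalField F]

/-- The filtration in coordinates: `P_D^{2k} = ϖ^k (O_E + O_E δ)` and
`P_D^{2k+1} = ϖ^k (ϖ O_E + O_E δ)`. -/
theorem mem_PD_iff (hp : ringChar 𝓀[F] ≠ 2) (hϖ : Irreducible ϖ) (hz : IsUnit z)
    (hz' : ¬ IsSquare (z : F)) {r : ℕ} {x : D z ϖ} :
    x ∈ PD z ϖ r ↔ absE (fstE x) ≤ valuation F (ϖ : F) ^ ((r + 1) / 2) ∧
      absE (sndE x) ≤ valuation F (ϖ : F) ^ (r / 2) := by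
  have h0 := valuation_uniformizer_ne_zero hϖ
  have h0' : 0 < valuation F (ϖ : F) := zero_lt_iff.2 h0
  induction r generalizing x with
  | zero =>
    simp only [mem_PD_zero, zero_add, Nat.reduceDiv, pow_zero]
    exact (mem_OE_iff hp hz hz').and (mem_OE_iff hp hz hz')
  | succ r ih =>
    have e : (r + 1 + 1) / 2 = r / 2 + 1 := by omega
    rw [mem_PD_succ, e]
    constructor
    · rintro ⟨y, hy, rfl⟩
      have hy := ih.1 hy
      rw [fstE_mul_δ, sndE_mul_δ, absE_mul hp hz hz', absE_algebraMap, pow_succ']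
      exact ⟨mul_le_mul_right hy.2 _, hy.1⟩
    · rintro ⟨h1, h2⟩
      have h3 : ∀ t : F, valuation F t ≤ valuation F (ϖ : F) ^ (r / 2 + 1) →
          valuation F (t / ϖ) ≤ valuation F (ϖ : F) ^ (r / 2) := by
        intro t ht
        rw [map_div₀, div_le_iff₀ h0', ← pow_succ]
        exact ht
      rw [absE_le_iff] at h1
      have hϖ0 : (ϖ : F) ≠ 0 := fun h => h0 (by simp [h])
      refine ⟨mkD (sndE x) ⟨(fstE x).re / ϖ, (fstE x).im / ϖ⟩, ih.2 ⟨h2, ?_⟩,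
        D.ext_components ?_ ?_⟩
      · rw [sndE_mkD, absE_le_iff]
        exact ⟨h3 _ h1.1, h3 _ h1.2⟩
      · have : algebraMap 𝒪[F] (E z) ϖ = ⟨(ϖ : F), 0⟩ := rfl
        rw [fstE_mul_δ, sndE_mkD, this]
        ext <;> simp <;> field_simp
      · rw [sndE_mul_δ, fstE_mkD]

/-- If `N(a) - ϖ N(c)` is integral, then so are `a` and `c`: the valuations of `N(a)` and
`ϖ N(c)` have different parities, so these terms cannot cancel. -/
theorem absE_le_one_of_norm_sub_le_one (hp : ringChar 𝓀[F] ≠ 2) (hϖ : Irreducible ϖ)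
    (hz : IsUnit z) (hz' : ¬ IsSquare (z : F)) {a c : E z}
    (h : valuation F (a.norm - ϖ * c.norm) ≤ 1) :
    absE a ≤ 1 ∧ absE c ≤ 1 := by
  have ha := valuation_norm hp hz hz' a
  have hc : valuation F (ϖ * c.norm) = valuation F (ϖ : F) * absE c ^ 2 := by
    rw [map_mul, valuation_norm hp hz hz']
  have e : a.norm = (a.norm - ϖ * c.norm) + ϖ * c.norm := (sub_add_cancel _ _).symm
  obtain ⟨s, hs⟩ := exists_valuation_eq_absE a
  obtain ⟨t, ht⟩ := exists_valuation_eq_absE c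
  have hc1 : valuation F (ϖ * c.norm) ≤ 1 := by
    by_contra! hlt
    have h1 : valuation F a.norm = valuation F (ϖ * c.norm) := by
      rw [e]
      exact Valuation.map_add_eq_of_lt_right _ (h.trans_lt hlt)
    rw [ha, hc, hs, ht] at h1
    have ht0 : valuation F t ≠ 0 := fun h0 => by
      rw [hc, ht, h0] at hlt
      simp at hlt
    refine valuation_sq_ne_uniformizer hϖ (s / t) ?_
    rw [map_div₀, div_pow, h1, mul_div_assoc, div_self (pow_ne_zero 2 ht0), mul_one]
  constructor
  · refine (pow_le_one_iff_of_nonneg zero_le two_ne_zero).1 ?_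
    rw [← ha, e]
    exact Valuation.map_add_le _ h hc1
  · by_contra! hlt
    rw [hc, ht] at hc1
    rw [ht] at hlt
    have h0 : valuation F t ≠ 0 := (zero_lt_one.trans hlt).ne'
    have h1 : valuation F t⁻¹ ≤ valuation F (ϖ : F) :=
      (valuation_lt_one_iff_le hϖ).1 (by rw [map_inv₀]; exact inv_lt_one_of_one_lt₀ hlt)
    have h2 : 1 ≤ valuation F (ϖ : F) * valuation F t := by
      rw [map_inv₀] at h1
      calc (1 : ValueGroupWithZero F) = (valuation F t)⁻¹ * valuation F t :=
            (inv_mul_cancel₀ h0).symm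
        _ ≤ _ := mul_le_mul_left h1 _
    have h3 : valuation F t ≤ valuation F (ϖ : F) * valuation F t ^ 2 := by
      calc valuation F t = 1 * valuation F t := (one_mul _).symm
        _ ≤ valuation F (ϖ : F) * valuation F t * valuation F t := mul_le_mul_left h2 _
        _ = _ := by rw [pow_two, mul_assoc]
    exact hlt.not_ge (h3.trans hc1)

theorem absE_le_one_of_D1 (hp : ringChar 𝓀[F] ≠ 2) (hϖ : Irreducible ϖ) (hz : IsUnit z)
    (hz' : ¬ IsSquare (z : F)) (x : D1 z ϖ) :
    absE (fstE (x : D z ϖ)) ≤ 1 ∧ absE (sndE (x : D z ϖ)) ≤ 1 :=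
  absE_le_one_of_norm_sub_le_one hp hϖ hz hz' (by rw [nrd_D1, map_one])

theorem coe_D1_mem_OD (hp : ringChar 𝓀[F] ≠ 2) (hϖ : Irreducible ϖ) (hz : IsUnit z)
    (hz' : ¬ IsSquare (z : F)) (x : D1 z ϖ) : (x : D z ϖ) ∈ OD z ϖ :=
  ⟨(mem_OE_iff hp hz hz').2 (absE_le_one_of_D1 hp hϖ hz hz' x).1,
    (mem_OE_iff hp hz hz').2 (absE_le_one_of_D1 hp hϖ hz hz' x).2⟩

theorem normal_D1r (hp : ringChar 𝓀[F] ≠ 2) (hϖ : Irreducible ϖ) (hz : IsUnit z)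
    (hz' : ¬ IsSquare (z : F)) (r : ℕ) : (D1r z ϖ r).Normal := by
  refine ⟨fun x hx g => ?_⟩
  rw [mem_D1r] at *
  have e : ((g * x * g⁻¹ : D1 z ϖ) : D z ϖ) - 1 =
      g * ((x : D z ϖ) - 1) * ((g⁻¹ : D1 z ϖ) : D z ϖ) := by
    have h : (g : D z ϖ) * ((g⁻¹ : D1 z ϖ) : D z ϖ) = 1 := by
      rw [← Submonoid.coe_mul, mul_inv_cancel, Submonoid.coe_one]
    rw [mul_sub, sub_mul, mul_one, h]
    rfl
  rw [e]
  exact PD_mul_right (PD_mul_left hx (coe_D1_mem_OD hp hϖ hz hz' g))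
    (coe_D1_mem_OD hp hϖ hz hz' g⁻¹)

/-- If `a + c δ` has norm one and `c` is divisible by `ϖ ^ k`, then `N(a) ≡ 1` modulo
`ϖ ^ (2 k + 1)`, so that `N(a)` is the square of some `s ≡ 1`; dividing by the element `a / s`
of `E¹` gives an element of `D¹_{2k+1}`. -/
theorem exists_torus_mul_of_sndE_le (hp : ringChar 𝓀[F] ≠ 2) (hϖ : Irreducible ϖ) (hz : IsUnit z)
    (hz' : ¬ IsSquare (z : F)) {k : ℕ} {x : D1 z ϖ}
    (hx : absE (sndE (x : D z ϖ)) ≤ valuation F (ϖ : F) ^ k) :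
    ∃ l : E1 z, ∃ y ∈ D1r z ϖ (2 * k + 1), x = torus l * y := by
  have hϖ1 := valuation_uniformizer_lt_one hϖ
  have hN := nrd_D1 x
  set a := fstE (x : D z ϖ) with ha
  set c := sndE (x : D z ϖ) with hc
  have hc1 : valuation F (ϖ * c.norm) ≤ valuation F (ϖ : F) ^ (2 * k + 1) := by
    rw [map_mul, valuation_norm hp hz hz', pow_succ' _ (2 * k), mul_comm 2 k, pow_mul]
    exact mul_le_mul_right (pow_le_pow_left' hx 2) _
  have hc2 : valuation F (ϖ * c.norm) < 1 := hc1.trans_lt (pow_lt_one₀ zero_le hϖ1 (by omega))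
  have hu : valuation F a.norm ≤ 1 := by
    rw [show a.norm = 1 + ϖ * c.norm by linear_combination hN]
    exact Valuation.map_add_le _ (map_one _).le hc2.le
  obtain ⟨s, hs, hs1⟩ := exists_sq_eq_of_sub_sq_mem hp (u := ⟨a.norm, hu⟩) (t := 1) isUnit_one (by
    rw [mem_maximalIdeal_iff_valuation_lt_one]
    have : ((⟨a.norm, hu⟩ - 1 ^ 2 : 𝒪[F]) : F) = ϖ * c.norm := by
      rw [one_pow]
      change a.norm - 1 = _
      linear_combination hN
    rwa [this])
  have hs' : (s : F) ^ 2 = a.norm := congrArg Subtype.val hs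
  rw [mem_maximalIdeal_iff_valuation_lt_one] at hs1
  have hs1' : valuation F ((s : F) - 1) < 1 := hs1
  have hsv : valuation F (s : F) = 1 := by
    rw [show (s : F) = 1 + (s - 1) by ring]
    exact Valuation.map_one_add_of_lt _ hs1'
  have hs0 : (s : F) ≠ 0 := fun h => by simp [h] at hsv
  have hs2 : valuation F ((s : F) + 1) = 1 := by
    rw [show (s : F) + 1 = 2 + (s - 1) by ring, Valuation.map_add_eq_of_lt_left,
      valuation_two hp]
    rwa [valuation_two hp]
  -- `s + 1 ≡ 2` is a unit, so `s - 1` is as small as `s ^ 2 - 1`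
  have hs3 : valuation F ((s : F) - 1) ≤ valuation F (ϖ : F) ^ (2 * k + 1) := by
    have : ((s : F) - 1) * (s + 1) = ϖ * c.norm := by linear_combination hs' + hN
    rw [← this, map_mul, hs2, mul_one] at hc1
    exact hc1
  let l : E1 z := ⟨⟨a.re / s, a.im / s⟩, by
    rw [← QuadraticAlgebra.norm_eq_one_iff_mem_unitary, normE_eq]
    rw [normE_eq] at hs'
    field_simp
    exact hs'.symm⟩
  have hla : star (l : E z) * a = algebraMap 𝒪[F] (E z) s := by
    have : algebraMap 𝒪[F] (E z) s = ⟨(s : F), 0⟩ := rfl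
    rw [normE_eq] at hs'
    rw [this]
    ext
    · simp [l]
      field_simp
      linear_combination -hs'
    · simp [l]
      ring
  refine ⟨l, (torus l)⁻¹ * x, ?_, by rw [mul_inv_cancel_left]⟩
  have e1 : fstE (((torus l)⁻¹ * x : D1 z ϖ) : D z ϖ) = algebraMap 𝒪[F] (E z) s := by
    rw [Submonoid.coe_mul, fstE_mul, coe_inv_D1, coe_torus, ← ofE_star, fstE_ofE, sndE_ofE,
      zero_mul, mul_zero, add_zero, hla]
  have e2 : sndE (((torus l)⁻¹ * x : D1 z ϖ) : D z ϖ) = star (l : E z) * c := by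
    rw [Submonoid.coe_mul, sndE_mul, coe_inv_D1, coe_torus, ← ofE_star, fstE_ofE, sndE_ofE,
      zero_mul, add_zero]
  rw [mem_D1r, mem_PD_iff hp hϖ hz hz', fstE_sub, sndE_sub, e1, e2, fstE_one, sndE_one, sub_zero,
    absE_mul hp hz hz', absE_star, absE_eq_one_of_norm hp hz hz', one_mul,
    show (2 * k + 1 + 1) / 2 = k + 1 by omega, show (2 * k + 1) / 2 = k by omega]
  refine ⟨?_, hx⟩
  rw [← map_one (algebraMap 𝒪[F] (E z)), ← map_sub, absE_algebraMap]
  exact hs3.trans (pow_le_pow_right_of_le_one' hϖ1.le (by omega))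

theorem torus_mul_D1r_eq (hp : ringChar 𝓀[F] ≠ 2) (hϖ : Irreducible ϖ) (hz : IsUnit z)
    (hz' : ¬ IsSquare (z : F)) (k : ℕ) :
    ((torus (z := z) (ϖ := ϖ)).range : Set (D1 z ϖ)) * (D1r z ϖ (2 * k) : Set (D1 z ϖ)) =
      ((torus (z := z) (ϖ := ϖ)).range : Set (D1 z ϖ)) *
        (D1r z ϖ (2 * k + 1) : Set (D1 z ϖ)) := by
  refine Set.Subset.antisymm ?_ (Set.mul_subset_mul_left D1r_succ_le)
  rintro _ ⟨_, ⟨l, rfl⟩, x, hx, rfl⟩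
  have hx' := ((mem_PD_iff hp hϖ hz hz').1 (mem_D1r.1 hx)).2
  rw [sndE_sub, sndE_one, sub_zero, Nat.mul_div_cancel_left k two_pos] at hx'
  obtain ⟨l', y, hy, rfl⟩ := exists_torus_mul_of_sndE_le hp hϖ hz hz' hx'
  exact ⟨torus (l * l'), ⟨_, rfl⟩, y, hy, by simp only [map_mul, mul_assoc]⟩

theorem mem_ED_iff (hp : ringChar 𝓀[F] ≠ 2) (hϖ : Irreducible ϖ) (hz : IsUnit z)
    (hz' : ¬ IsSquare (z : F)) {r : ℕ} {x : D1 z ϖ} :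
    x ∈ ED z ϖ r ↔ ∃ l : E1 z, ∃ y ∈ D1r z ϖ r, x = torus l * y := by
  have := normal_D1r hp hϖ hz hz' r
  rw [ED, Subgroup.mem_sup_of_normal_right]
  constructor
  · rintro ⟨_, ⟨l, rfl⟩, y, hy, rfl⟩
    exact ⟨l, y, hy, rfl⟩
  · rintro ⟨l, y, hy, rfl⟩
    exact ⟨_, ⟨l, rfl⟩, y, hy, rfl⟩

theorem ED_eq_ED_succ (hp : ringChar 𝓀[F] ≠ 2) (hϖ : Irreducible ϖ) (hz : IsUnit z)
    (hz' : ¬ IsSquare (z : F)) (k : ℕ) : ED z ϖ (2 * k) = ED z ϖ (2 * k + 1) := by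
  have h1 := normal_D1r hp hϖ hz hz' (2 * k)
  have h2 := normal_D1r hp hϖ hz hz' (2 * k + 1)
  refine SetLike.coe_injective ?_
  rw [ED, ED, Subgroup.mul_normal, Subgroup.mul_normal]
  exact torus_mul_D1r_eq hp hϖ hz hz' k

end Filtration

/-! ### The decomposition `U(2) = D¹ ⋊ E¹` -/

section Decomposition

theorem algebraMap_mul_star_eq (t : 𝒪[F]) (a : E z) :
    algebraMap 𝒪[F] (E z) t * (a * star a) = algebraMap F (E z) (t * a.norm) := by
  rw [map_mul, ← mul_star_eq_algebraMap_norm]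
  rfl

theorem norm_sub_eq_one_iff {a c : E z} : a.norm - ϖ * c.norm = 1 ↔
    a * star a - algebraMap 𝒪[F] (E z) ϖ * (c * star c) = 1 := by
  rw [algebraMap_mul_star_eq, mul_star_eq_algebraMap_norm, ← map_sub,
    ← map_one (algebraMap F (E z)), (algebraMap F (E z)).injective.eq_iff]

theorem mkD_mem_D1_iff {a c : E z} : (mkD a c : D z ϖ) ∈ unitary (D z ϖ) ↔
    a * star a - algebraMap 𝒪[F] (E z) ϖ * (c * star c) = 1 := by
  rw [mem_D1_iff, nrd_eq, fstE_mkD, sndE_mkD, norm_sub_eq_one_iff]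

theorem E1.mul_star_self (l : E1 z) : (l : E z) * star (l : E z) = 1 :=
  Unitary.mul_star_self_of_mem l.2

theorem D1.mul_star_sub (x : D1 z ϖ) : fstE (x : D z ϖ) * star (fstE (x : D z ϖ)) -
    algebraMap 𝒪[F] (E z) ϖ * (sndE (x : D z ϖ) * star (sndE (x : D z ϖ))) = 1 :=
  norm_sub_eq_one_iff.1 (nrd_D1 x)

/-- The underlying matrix of an element of `U(2)`. -/
abbrev U2.mat (g : U2 z ϖ) : Matrix (Fin 2) (Fin 2) (E z) := ((g : GL (Fin 2) (E z)) : Matrix _ _ _)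

theorem U2.ext_mat {g g' : U2 z ϖ} (h : U2.mat g = U2.mat g') : g = g' :=
  Subtype.ext (Units.ext h)

theorem mat_ι_mul_diagE (x : D1 z ϖ) (l : E1 z) : U2.mat (ι x * diagE l) =
    !![fstE (x : D z ϖ), sndE (x : D z ϖ) * l;
      algebraMap 𝒪[F] (E z) ϖ * star (sndE (x : D z ϖ)), star (fstE (x : D z ϖ)) * l] := by
  have h1 : U2.mat (ι x * diagE l) = mat (x : D z ϖ) * !![1, 0; 0, (l : E z)] := rfl
  rw [h1]
  simp [mat]

theorem det_ι_mul_diagE (x : D1 z ϖ) (l : E1 z) : (U2.mat (ι x * diagE l)).det = l := by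
  rw [mat_ι_mul_diagE, Matrix.det_fin_two_of]
  linear_combination (l : E z) * D1.mul_star_sub x

theorem ι_mul_diagE_injective {x x' : D1 z ϖ} {l l' : E1 z}
    (h : ι x * diagE l = ι x' * diagE l') : x = x' ∧ l = l' := by
  have hl : l = l' := Subtype.ext (by rw [← det_ι_mul_diagE x l, h, det_ι_mul_diagE])
  refine ⟨?_, hl⟩
  subst hl
  have h1 : mat (x : D z ϖ) = mat (x' : D z ϖ) := congrArg U2.mat (mul_right_cancel h)
  exact Subtype.ext (D.ext_components (congrFun₂ h1 0 0) (congrFun₂ h1 0 1))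

/-- `U(2) = D¹ ⋊ E¹`: the projection to the factor `E¹` is the determinant. -/
theorem exists_eq_ι_mul_diagE (hϖ : ϖ ≠ 0) (g : U2 z ϖ) : ∃ (x : D1 z ϖ) (l : E1 z),
    g = ι x * diagE l ∧ fstE (x : D z ϖ) = U2.mat g 0 0 ∧
      sndE (x : D z ϖ) = U2.mat g 0 1 * star (l : E z) ∧ (l : E z) = (U2.mat g).det := by
  have hg : U2.mat g * gram z ϖ * (U2.mat g)ᴴ = gram z ϖ := g.2
  have hπ := star_algebraMap (z := z) ϖ
  have hπ0 : IsLeftRegular (algebraMap 𝒪[F] (E z) ϖ) := by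
    intro a b hab
    have : algebraMap 𝒪[F] (E z) ϖ = ⟨(ϖ : F), 0⟩ := rfl
    have h0 : (ϖ : F) ≠ 0 := fun h => hϖ (Subtype.ext h)
    have h1 := congrArg QuadraticAlgebra.re hab
    have h2 := congrArg QuadraticAlgebra.im hab
    ext
    · simpa [this, h0] using h1
    · simpa [this, h0] using h2
  set M := U2.mat g with hM
  set a := M 0 0 with ha
  set b := M 0 1 with hb
  set c := M 1 0 with hc
  set d := M 1 1 with hd
  have h00 := congrFun₂ hg 0 0
  have h01 := congrFun₂ hg 0 1
  have h11 := congrFun₂ hg 1 1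
  have h10 := congrFun₂ hg 1 0
  simp only [gram, Matrix.mul_apply, Fin.sum_univ_two, Matrix.conjTranspose_apply,
    Matrix.of_apply, Matrix.cons_val', Matrix.cons_val_zero, Matrix.cons_val_one,
    Matrix.cons_val_fin_one, ← ha, ← hb, ← hc, ← hd] at h00 h01 h10 h11
  have hdet : M.det = a * d - b * c := Matrix.det_fin_two M
  have hl : M.det * star M.det = 1 := by
    apply hπ0
    have h1 := congrArg Matrix.det hg
    rw [Matrix.det_mul, Matrix.det_mul, Matrix.det_conjTranspose, gram, Matrix.det_fin_two_of] at h1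
    linear_combination -h1
  have e1 : star a * M.det = d := by
    rw [hdet]
    linear_combination d * h00 - b * h10
  have e2 : algebraMap 𝒪[F] (E z) ϖ * star b * M.det = c := by
    rw [hdet]
    linear_combination c * h00 - a * h10
  let l : E1 z := ⟨M.det, by rw [Unitary.mem_iff, mul_comm, and_self]; exact hl⟩
  let x : D1 z ϖ := ⟨mkD a (b * star (l : E z)), by
    rw [mkD_mem_D1_iff, star_mul', star_star]
    simp only [l]
    linear_combination h00 - algebraMap 𝒪[F] (E z) ϖ * b * star b * hl⟩
  refine ⟨x, l, U2.ext_mat ?_, rfl, rfl, rfl⟩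
  rw [mat_ι_mul_diagE, ← hM, Matrix.eta_fin_two M]
  simp only [x, fstE_mkD, sndE_mkD, l, ← ha, ← hb, ← hc, ← hd, star_mul', star_star]
  ext1 i j
  fin_cases i <;> fin_cases j
  · rfl
  · simp only [Matrix.of_apply, Matrix.cons_val', Matrix.cons_val_zero, Matrix.cons_val_one,
      Matrix.cons_val_fin_one, Fin.zero_eta, Fin.mk_one]
    linear_combination -b * hl
  · simp only [Matrix.of_apply, Matrix.cons_val', Matrix.cons_val_zero, Matrix.cons_val_one,
      Matrix.cons_val_fin_one, Fin.zero_eta, Fin.mk_one]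
    linear_combination -e2
  · exact e1.symm

/-- The automorphism `a + c δ ↦ a + c λ⁻¹ δ` of `D¹` by which `λ` acts in `U(2) = D¹ ⋊ E¹`. -/
def twist (l : E1 z) (x : D1 z ϖ) : D1 z ϖ :=
  ⟨mkD (fstE (x : D z ϖ)) (sndE (x : D z ϖ) * star (l : E z)), by
    rw [mkD_mem_D1_iff, star_mul', star_star]
    linear_combination D1.mul_star_sub x - algebraMap 𝒪[F] (E z) ϖ * sndE (x : D z ϖ) *
      star (sndE (x : D z ϖ)) * E1.mul_star_self l⟩

@[simp] theorem fstE_twist (l : E1 z) (x : D1 z ϖ) :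
    fstE (twist l x : D z ϖ) = fstE (x : D z ϖ) := rfl

@[simp] theorem sndE_twist (l : E1 z) (x : D1 z ϖ) :
    sndE (twist l x : D z ϖ) = sndE (x : D z ϖ) * star (l : E z) := rfl

theorem diagE_mul_ι (l : E1 z) (x : D1 z ϖ) : diagE l * ι x = ι (twist l x) * diagE l := by
  refine U2.ext_mat ?_
  rw [mat_ι_mul_diagE]
  have h1 : U2.mat (diagE l * ι x) = !![1, 0; 0, (l : E z)] * mat (x : D z ϖ) := rfl
  rw [h1]
  simp only [mat, MonoidHom.coe_mk, OneHom.coe_mk, Matrix.mul_fin_two, fstE_twist, sndE_twist,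
    star_mul', star_star, one_mul, zero_mul, add_zero, zero_add]
  rw [mul_assoc (sndE (x : D z ϖ)), mul_comm (star (l : E z)), E1.mul_star_self, mul_one,
    mul_left_comm, mul_comm (l : E z), mul_comm (l : E z)]

theorem twist_torus_mul (l l' : E1 z) (x : D1 z ϖ) :
    twist l (torus l' * x) = torus l' * twist l x := by
  refine Subtype.ext (D.ext_components ?_ ?_)
  · simp [fstE_mul]
  · simp [sndE_mul, mul_assoc]

end Decomposition

section Filtration

variable [TopologicalSpace F] [IsNonarchimedeanLocalField F]

theorem twist_mem_D1r (hp : ringChar 𝓀[F] ≠ 2) (hϖ : Irreducible ϖ) (hz : IsUnit z)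
    (hz' : ¬ IsSquare (z : F)) {r : ℕ} (l : E1 z) {x : D1 z ϖ} (hx : x ∈ D1r z ϖ r) :
    twist l x ∈ D1r z ϖ r := by
  rw [mem_D1r, mem_PD_iff hp hϖ hz hz'] at *
  simpa [absE_mul hp hz hz', absE_eq_one_of_norm hp hz hz'] using hx

theorem twist_mem_ED (hp : ringChar 𝓀[F] ≠ 2) (hϖ : Irreducible ϖ) (hz : IsUnit z)
    (hz' : ¬ IsSquare (z : F)) {r : ℕ} (l : E1 z) {x : D1 z ϖ} (hx : x ∈ ED z ϖ r) :
    twist l x ∈ ED z ϖ r := by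
  rw [mem_ED_iff hp hϖ hz hz'] at *
  obtain ⟨l', y, hy, rfl⟩ := hx
  exact ⟨l', _, twist_mem_D1r hp hϖ hz hz' l hy, twist_torus_mul l l' y⟩

theorem mem_EDE_iff (hp : ringChar 𝓀[F] ≠ 2) (hϖ : Irreducible ϖ) (hz : IsUnit z)
    (hz' : ¬ IsSquare (z : F)) {r : ℕ} {g : U2 z ϖ} :
    g ∈ EDE z ϖ r ↔ ∃ x ∈ ED z ϖ r, ∃ l : E1 z, g = ι x * diagE l := by
  constructor
  · intro hg
    rw [EDE, Subgroup.sup_eq_closure] at hg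
    induction hg using Subgroup.closure_induction with
    | mem g hg =>
      rcases hg with ⟨x, hx, rfl⟩ | ⟨l, rfl⟩
      · exact ⟨x, hx, 1, by simp⟩
      · exact ⟨1, one_mem _, l, by simp⟩
    | one => exact ⟨1, one_mem _, 1, by simp⟩
    | mul g g' _ _ h h' =>
      obtain ⟨x, hx, l, rfl⟩ := h
      obtain ⟨x', hx', l', rfl⟩ := h'
      refine ⟨x * twist l x', mul_mem hx (twist_mem_ED hp hϖ hz hz' l hx'), l * l', ?_⟩
      rw [map_mul, map_mul, mul_assoc, ← mul_assoc (diagE l), diagE_mul_ι]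
      simp only [mul_assoc]
    | inv g _ h =>
      obtain ⟨x, hx, l, rfl⟩ := h
      refine ⟨twist l⁻¹ x⁻¹, twist_mem_ED hp hϖ hz hz' _ (inv_mem hx), l⁻¹, ?_⟩
      rw [mul_inv_rev, ← map_inv, ← map_inv, diagE_mul_ι]
  · rintro ⟨x, hx, l, rfl⟩
    exact mul_mem (Subgroup.mem_sup_left ⟨x, hx, rfl⟩) (Subgroup.mem_sup_right ⟨l, rfl⟩)

end Filtration

/-! ### Topology of `U(2)` -/

section Gram

theorem exists_gram_mul_eq_one (hϖ : ϖ ≠ 0) :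
    ∃ B : Matrix (Fin 2) (Fin 2) (E z), gram z ϖ * B = 1 := by
  have hϖ0 : (ϖ : F) ≠ 0 := fun h => hϖ (Subtype.ext h)
  refine ⟨!![1, 0; 0, -algebraMap F (E z) (ϖ : F)⁻¹], ?_⟩
  have h1 : algebraMap 𝒪[F] (E z) ϖ * algebraMap F (E z) (ϖ : F)⁻¹ = 1 := by
    have : algebraMap 𝒪[F] (E z) ϖ = algebraMap F (E z) ϖ := rfl
    rw [this, ← map_mul, mul_inv_cancel₀ hϖ0, map_one]
  rw [gram, Matrix.mul_fin_two, Matrix.one_fin_two]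
  simp [h1]

theorem range_mat_eq (hϖ : ϖ ≠ 0) : Set.range (U2.mat (z := z) (ϖ := ϖ)) =
    {M | M * gram z ϖ * Mᴴ = gram z ϖ} := by
  refine Set.Subset.antisymm ?_ fun M hM => ?_
  · rintro _ ⟨g, rfl⟩
    exact g.2
  · obtain ⟨B, hB⟩ := exists_gram_mul_eq_one (z := z) hϖ
    have h : M * (gram z ϖ * Mᴴ * B) = 1 := by
      rw [← mul_assoc, ← mul_assoc, hM, hB]
    exact ⟨⟨⟨M, _, h, mul_eq_one_comm.1 h⟩, hM⟩, rfl⟩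

theorem coe_inv_U2 {B : Matrix (Fin 2) (Fin 2) (E z)} (hB : gram z ϖ * B = 1) (g : U2 z ϖ) :
    (((g : GL (Fin 2) (E z))⁻¹ : GL (Fin 2) (E z)) : Matrix (Fin 2) (Fin 2) (E z)) =
      gram z ϖ * (U2.mat g)ᴴ * B := by
  have hg : U2.mat g * gram z ϖ * (U2.mat g)ᴴ = gram z ϖ := g.2
  refine Units.inv_eq_of_mul_eq_one_right ?_
  rw [← mul_assoc, ← mul_assoc, hg, hB]

end Gram

section Topology

variable [TopologicalSpace F] [IsNonarchimedeanLocalField F]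

instance : ContinuousStar (E z) where
  continuous_star := by
    have h1 := QuadraticAlgebra.continuous_re' (a := (z : F)) (b := 0)
    have h2 := QuadraticAlgebra.continuous_im' (a := (z : F)) (b := 0)
    refine continuous_induced_rng.2 (Continuous.prodMk ?_ ?_)
    · simpa using h1
    · exact h2.neg.congr fun a => (QuadraticAlgebra.im_star a).symm

theorem t2Space_of_isNonarchimedeanLocalField : T2Space F := by
  let := IsTopologicalAddGroup.rightUniformSpace F
  have := isUniformAddGroup_of_addCommGroup (G := F)
  infer_instance

instance : T2Space (E z) :=
  have : T2Space F := t2Space_of_isNonarchimedeanLocalField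
  T2Space.of_injective_continuous (f := fun a : E z => (a.re, a.im))
    (fun _ _ h => QuadraticAlgebra.ext (congrArg Prod.fst h) (congrArg Prod.snd h))
    continuous_induced_dom

theorem isCompact_absE_le_one : IsCompact {a : E z | absE a ≤ 1} := by
  have h := IsNonarchimedeanLocalField.isCompact_closedBall F 1
  have hc : Continuous fun p : F × F => (⟨p.1, p.2⟩ : E z) :=
    continuous_induced_rng.2 continuous_id
  convert (h.prod h).image hc using 1
  ext a
  constructor
  · intro ha
    exact ⟨(a.re, a.im), absE_le_iff.1 ha, rfl⟩
  · rintro ⟨p, hp, rfl⟩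
    exact absE_le_iff.2 hp

theorem hasBasis_nhds_E (b : E z) :
    (nhds b).HasBasis (fun g : ValueGroupWithZero F => g ≠ 0) fun g => {a | absE (a - b) < g} := by
  have h := ((IsValuativeTopology.hasBasis_nhds' b.re).prod_same_index
    (IsValuativeTopology.hasBasis_nhds' b.im) (fun {g g'} hg hg' => ⟨min g g', by
      rcases min_choice g g' with h | h <;> rw [h] <;> assumption,
      fun x hx => lt_of_lt_of_le (b := min g g') hx (min_le_left _ _),
      fun x hx => lt_of_lt_of_le (b := min g g') hx (min_le_right _ _)⟩)).comap
    (fun x : E z => (x.re, x.im))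
  rw [← nhds_prod_eq, ← nhds_induced] at h
  refine h.to_hasBasis (fun g hg => ⟨g, hg, fun a ha => ?_⟩) (fun g hg => ⟨g, hg, fun a ha => ?_⟩)
  · exact max_lt_iff.1 (show max _ _ < g from ha)
  · exact max_lt_iff.2 (show _ < g ∧ _ < g from ha)

theorem absE_entry_le_one (hp : ringChar 𝓀[F] ≠ 2) (hϖ : Irreducible ϖ) (hz : IsUnit z)
    (hz' : ¬ IsSquare (z : F)) (g : U2 z ϖ) (i j : Fin 2) : absE (U2.mat g i j) ≤ 1 := by
  obtain ⟨x, l, rfl, -⟩ := exists_eq_ι_mul_diagE hϖ.ne_zero g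
  obtain ⟨h1, h2⟩ := absE_le_one_of_D1 hp hϖ hz hz' x
  have h3 := absE_eq_one_of_norm hp hz hz' l
  rw [mat_ι_mul_diagE]
  fin_cases i <;> fin_cases j
  · exact h1
  · simpa [absE_mul hp hz hz', h3] using h2
  · simpa [absE_mul hp hz hz'] using mul_le_one' (valuation_uniformizer_lt_one hϖ).le h2
  · simpa [absE_mul hp hz hz', h3] using h1

/-- On `U(2)` the topology of `GL₂(E)` is that of the matrix entries, since the inverse of `g` is
`J g* J⁻¹`. -/
theorem isInducing_mat (hϖ : ϖ ≠ 0) : Topology.IsInducing (U2.mat (z := z) (ϖ := ϖ)) := by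
  obtain ⟨B, hB⟩ := exists_gram_mul_eq_one (z := z) hϖ
  have hΨ : Continuous fun M : Matrix (Fin 2) (Fin 2) (E z) =>
      (M, MulOpposite.op (gram z ϖ * Mᴴ * B)) :=
    continuous_id.prodMk (MulOpposite.continuous_op.comp ((continuous_const.matrix_mul
      continuous_id.matrix_conjTranspose).matrix_mul continuous_const))
  refine Topology.IsInducing.of_comp (Units.continuous_val.comp continuous_subtype_val) hΨ ?_
  convert Units.isInducing_embedProduct.comp Topology.IsInducing.subtypeVal using 1
  funext g
  exact Prod.ext rfl (congrArg MulOpposite.op (coe_inv_U2 hB g).symm)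

theorem isCompact_range_mat (hp : ringChar 𝓀[F] ≠ 2) (hϖ : Irreducible ϖ) (hz : IsUnit z)
    (hz' : ¬ IsSquare (z : F)) : IsCompact (Set.range (U2.mat (z := z) (ϖ := ϖ))) := by
  refine IsCompact.of_isClosed_subset (isCompact_univ_pi fun _ : Fin 2 =>
    isCompact_univ_pi fun _ : Fin 2 => isCompact_absE_le_one (z := z)) ?_ ?_
  · rw [range_mat_eq hϖ.ne_zero]
    exact isClosed_eq ((continuous_id.matrix_mul continuous_const).matrix_mul
      continuous_id.matrix_conjTranspose) continuous_const
  · rintro _ ⟨g, rfl⟩ i _ j _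
    exact absE_entry_le_one hp hϖ hz hz' g i j

/-- `U(2)` is compact, being a closed group of matrices with integral entries. -/
theorem compactSpace_U2 (hp : ringChar 𝓀[F] ≠ 2) (hϖ : Irreducible ϖ) (hz : IsUnit z)
    (hz' : ¬ IsSquare (z : F)) : CompactSpace (U2 z ϖ) :=
  ⟨(isInducing_mat hϖ.ne_zero).isCompact_iff.2 (by
    rw [Set.image_univ]
    exact isCompact_range_mat hp hϖ hz hz')⟩

/-- A subgroup of `ℂˣ` close to `1` is trivial, since squaring increases the distance to `1`. -/
theorem eq_one_of_forall_pow_near_one {u : ℂ} (h : ∀ n : ℕ, ‖u ^ n - 1‖ < 1 / 2) : u = 1 := by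
  by_contra hu
  have h0 : 0 < ‖u - 1‖ := norm_pos_iff.2 (sub_ne_zero.2 hu)
  have key : ∀ n : ℕ, (3 / 2 : ℝ) ^ n * ‖u - 1‖ ≤ ‖u ^ 2 ^ n - 1‖ := by
    intro n
    induction n with
    | zero => simp
    | succ n ih =>
      have e : u ^ 2 ^ (n + 1) - 1 = (u ^ 2 ^ n + 1) * (u ^ 2 ^ n - 1) := by
        rw [pow_succ, pow_mul]; ring
      have h1 : (3 / 2 : ℝ) ≤ ‖u ^ 2 ^ n + 1‖ := by
        have h2 : ‖(2 : ℂ)‖ ≤ ‖u ^ 2 ^ n + 1‖ + ‖u ^ 2 ^ n - 1‖ := by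
          refine le_trans (le_of_eq ?_) (norm_sub_le _ _)
          congr 1; ring
        have h3 := h (2 ^ n)
        rw [Complex.norm_ofNat] at h2
        linarith
      rw [e, norm_mul, pow_succ']
      calc _ = 3 / 2 * ((3 / 2 : ℝ) ^ n * ‖u - 1‖) := by ring
        _ ≤ _ := mul_le_mul h1 ih (by positivity) (by positivity)
  obtain ⟨n, hn⟩ := pow_unbounded_of_one_lt (1 / 2 / ‖u - 1‖) (by norm_num : (1 : ℝ) < 3 / 2)
  rw [div_lt_iff₀ h0] at hn
  have := key n
  have := h (2 ^ n)
  linarith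

/-- A continuous character of `E¹` is trivial near `1`, as `1` has a basis of neighbourhoods that
are subgroups. -/
theorem eventually_character_eq_one (hp : ringChar 𝓀[F] ≠ 2) (hz : IsUnit z)
    (hz' : ¬ IsSquare (z : F)) {ζ : E1 z →* ℂˣ} (hζ : Continuous ζ) :
    ∀ᶠ l in nhds (1 : E1 z), ζ l = 1 := by
  have h1 : ∀ᶠ l in nhds (1 : E1 z), ‖((ζ l : ℂˣ) : ℂ) - 1‖ < 1 / 2 := by
    have hc : Continuous fun l => ‖((ζ l : ℂˣ) : ℂ) - 1‖ :=
      ((Units.continuous_val.comp hζ).sub continuous_const).norm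
    exact hc.continuousAt.eventually (gt_mem_nhds (by simp))
  rw [nhds_subtype] at h1 ⊢
  have hb := (hasBasis_nhds_E (1 : E z)).comap (Subtype.val : E1 z → E z)
  obtain ⟨g, hg, hgs⟩ := hb.eventually_iff.1 h1
  refine hb.eventually_iff.2 ⟨g, hg, fun l hl => ?_⟩
  have hl' : absE ((l : E z) - 1) < g := hl
  have key : ∀ n : ℕ, absE (((l ^ n : E1 z) : E z) - 1) < g := by
    intro n
    induction n with
    | zero => simpa using zero_lt_iff.2 hg
    | succ n ih =>
      have e : ((l ^ (n + 1) : E1 z) : E z) - 1 =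
          l * (((l ^ n : E1 z) : E z) - 1) + ((l : E z) - 1) := by
        rw [pow_succ', Submonoid.coe_mul]; ring
      have h2 : absE ((l : E z) * (((l ^ n : E1 z) : E z) - 1)) < g := by
        rwa [absE_mul hp hz hz', absE_eq_one_of_norm hp hz hz', one_mul]
      rw [e]
      exact (absE_add_le (le_max_left _ _) (le_max_right _ _)).trans_lt (max_lt h2 hl')
  refine Units.ext (eq_one_of_forall_pow_near_one fun n => ?_)
  have := hgs (key n)
  simpa using this

end Topology

/-! ### The characters `ψ_β` and `γ_{(β, ζ)}` -/

section Trace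

theorem trd_eq (x : D z ϖ) : trd x = 2 * (fstE x).re := by
  simp [trd, fstE]
  ring

theorem trd_add (x y : D z ϖ) : trd (x + y) = trd x + trd y := by
  simp only [trd_eq, fstE_add, QuadraticAlgebra.re_add]
  ring

theorem trd_sub (x y : D z ϖ) : trd (x - y) = trd x - trd y := by
  simp only [trd_eq, fstE_sub, QuadraticAlgebra.re_sub]
  ring

theorem trd_mul_comm (x y : D z ϖ) : trd (x * y) = trd (y * x) := by
  rw [trd_eq, trd_eq]
  congr 1
  simp [fstE]
  ring

variable [TopologicalSpace F] [IsNonarchimedeanLocalField F]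

/-- The normalization `v_D(β) = -2m` in coordinates: since the two terms of
`N(β) = N(a) - ϖ N(c)` have valuations of different parities, it is `N(a)` that attains the even
valuation `-2m`. -/
theorem absE_of_hasValD (hp : ringChar 𝓀[F] ≠ 2) (hϖ : Irreducible ϖ) (hz : IsUnit z)
    (hz' : ¬ IsSquare (z : F)) {m : ℕ} {β : D z ϖ} (hβ : HasValD β (-(2 * m : ℤ))) :
    absE (fstE β) = (valuation F (ϖ : F) ^ m)⁻¹ ∧
      absE (sndE β) ≤ (valuation F (ϖ : F) ^ m)⁻¹ := by
  have h0 := valuation_uniformizer_ne_zero hϖ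
  have hpm : valuation F (ϖ : F) ^ m ≠ 0 := pow_ne_zero m h0
  let t : E z := algebraMap 𝒪[F] (E z) (ϖ ^ m)
  have ht : t.norm = (ϖ : F) ^ (2 * m) := by
    have : t = algebraMap F (E z) ((ϖ : F) ^ m) := rfl
    rw [this, QuadraticAlgebra.norm_algebraMap, ← pow_mul, mul_comm]
  have htv : absE t = valuation F (ϖ : F) ^ m := by
    rw [absE_algebraMap, SubmonoidClass.coe_pow, map_pow]
  have h1 : valuation F ((t * fstE β).norm - ϖ * (t * sndE β).norm) = 1 := by
    have e : (t * fstE β).norm - ϖ * (t * sndE β).norm = (ϖ : F) ^ (2 * m) * nrd β := by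
      rw [map_mul, map_mul, ht, nrd_eq]; ring
    have hβ' : valuation F (nrd β) = _ := hβ
    rw [e, map_mul, map_pow, hβ', ← zpow_natCast, ← zpow_add₀ h0]
    simp
  obtain ⟨ha, hc⟩ := absE_le_one_of_norm_sub_le_one hp hϖ hz hz' h1.le
  have ha1 : absE (t * fstE β) = 1 := by
    have h2 : valuation F (ϖ * (t * sndE β).norm) < 1 := by
      rw [map_mul, valuation_norm hp hz hz']
      exact (mul_le_of_le_one_right' (pow_le_one' hc 2)).trans_lt
        (valuation_uniformizer_lt_one hϖ)
    have h3 : valuation F (t * fstE β).norm = 1 := by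
      rw [← sub_add_cancel (t * fstE β).norm (ϖ * (t * sndE β).norm),
        Valuation.map_add_eq_of_lt_left, h1]
      rwa [h1]
    rw [valuation_norm hp hz hz'] at h3
    exact (pow_eq_one_iff_of_nonneg zero_le two_ne_zero).1 h3
  rw [absE_mul hp hz hz', htv] at ha1 hc
  refine ⟨eq_inv_of_mul_eq_one_right ha1, ?_⟩
  rw [← mul_one (valuation F (ϖ : F) ^ m)⁻¹]
  exact (le_inv_mul_iff₀ (zero_lt_iff.2 hpm)).2 hc

theorem valuation_trd_mul_lt_one (hp : ringChar 𝓀[F] ≠ 2) (hϖ : Irreducible ϖ) (hz : IsUnit z)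
    (hz' : ¬ IsSquare (z : F)) {m : ℕ} {β w : D z ϖ} (hβ : HasValD β (-(2 * m : ℤ)))
    (hw : w ∈ PD z ϖ (2 * m + 1)) : valuation F (trd (β * w)) < 1 := by
  have h0 := valuation_uniformizer_ne_zero hϖ
  have hpm : valuation F (ϖ : F) ^ m ≠ 0 := pow_ne_zero m h0
  obtain ⟨ha, hc⟩ := absE_of_hasValD hp hϖ hz hz' hβ
  rw [mem_PD_iff hp hϖ hz hz', show (2 * m + 1 + 1) / 2 = m + 1 by omega,
    show (2 * m + 1) / 2 = m by omega] at hw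
  rw [trd_eq, map_mul, valuation_two hp, one_mul]
  refine (le_max_left _ _ : _ ≤ absE (fstE (β * w))).trans_lt ?_
  rw [fstE_mul]
  refine (absE_add_le ?_ ?_).trans_lt (valuation_uniformizer_lt_one hϖ)
  · rw [absE_mul hp hz hz', ha]
    calc _ ≤ (valuation F (ϖ : F) ^ m)⁻¹ * valuation F (ϖ : F) ^ (m + 1) := mul_le_mul_right hw.1 _
      _ = _ := by rw [pow_succ, inv_mul_cancel_left₀ hpm]
  · rw [absE_mul hp hz hz', absE_mul hp hz hz', absE_star, absE_algebraMap]
    refine mul_le_of_le_one_right' ?_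
    calc _ ≤ (valuation F (ϖ : F) ^ m)⁻¹ * valuation F (ϖ : F) ^ m := mul_le_mul' hc hw.2
      _ = _ := inv_mul_cancel₀ hpm

end Trace

section PsiB

variable {ψ : AddChar F ℂ}

theorem psiB_one (β : D z ϖ) : psiB ψ β 1 = 1 := by
  simp [psiB, trd_eq, fstE]

theorem psiB_ne_zero (β : D z ϖ) (x : D1 z ϖ) : psiB ψ β x ≠ 0 := fun h => by
  have := AddChar.map_add_eq_mul ψ (trd (β * ((x : D z ϖ) - 1))) (-trd (β * ((x : D z ϖ) - 1)))
  rw [show ψ (trd (β * ((x : D z ϖ) - 1))) = 0 from h, zero_mul, add_neg_cancel,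
    AddChar.map_zero_eq_one] at this
  exact one_ne_zero this

theorem psiB_ofE_congr (b : E z) {x y : D1 z ϖ} (h : fstE (x : D z ϖ) = fstE (y : D z ϖ)) :
    psiB ψ (ofE b) x = psiB ψ (ofE b) y := by
  rw [psiB, psiB, trd_eq, trd_eq, fstE_mul, fstE_mul, fstE_sub, fstE_sub, h, sndE_ofE, zero_mul,
    zero_mul]

variable [TopologicalSpace F] [IsNonarchimedeanLocalField F]

theorem psiB_eq_one_of_mem (hp : ringChar 𝓀[F] ≠ 2) (hϖ : Irreducible ϖ) (hz : IsUnit z)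
    (hz' : ¬ IsSquare (z : F)) (hψ : HasConductorP ψ) {m : ℕ} {β : D z ϖ}
    (hβ : HasValD β (-(2 * m : ℤ))) {x : D1 z ϖ} (hx : x ∈ D1r z ϖ (2 * m + 1)) :
    psiB ψ β x = 1 :=
  hψ.1 _ (valuation_trd_mul_lt_one hp hϖ hz hz' hβ hx)

theorem psiB_mul (hp : ringChar 𝓀[F] ≠ 2) (hϖ : Irreducible ϖ) (hz : IsUnit z)
    (hz' : ¬ IsSquare (z : F)) (hψ : HasConductorP ψ) {m : ℕ} {β : D z ϖ}
    (hβ : HasValD β (-(2 * m : ℤ))) {x y : D1 z ϖ} (hx : x ∈ D1r z ϖ (m + 1))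
    (hy : y ∈ D1r z ϖ (m + 1)) : psiB ψ β (x * y) = psiB ψ β x * psiB ψ β y := by
  have e : β * (((x * y : D1 z ϖ) : D z ϖ) - 1) = β * ((x : D z ϖ) - 1) + β * ((y : D z ϖ) - 1) +
      β * (((x : D z ϖ) - 1) * ((y : D z ϖ) - 1)) := by
    rw [Submonoid.coe_mul]; noncomm_ring
  have h1 : ((x : D z ϖ) - 1) * ((y : D z ϖ) - 1) ∈ PD z ϖ (2 * m + 1) := by
    have := PD_mul hx hy
    rw [show m + 1 + (m + 1) = 2 * m + 1 + 1 by omega] at this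
    exact PD_succ_subset this
  rw [psiB, e, trd_add, trd_add, AddChar.map_add_eq_mul, AddChar.map_add_eq_mul,
    hψ.1 _ (valuation_trd_mul_lt_one hp hϖ hz hz' hβ h1), mul_one]
  rfl

end PsiB

section Existence

variable [TopologicalSpace F] [IsNonarchimedeanLocalField F]
variable {ψ : AddChar F ℂ}

theorem exists_eq_of_mem_EDE (hp : ringChar 𝓀[F] ≠ 2) (hϖ : Irreducible ϖ) (hz : IsUnit z)
    (hz' : ¬ IsSquare (z : F)) {m : ℕ} (hm : Even m) {g : U2 z ϖ} (hg : g ∈ EDE z ϖ m) :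
    ∃ l l' : E1 z, ∃ x ∈ D1r z ϖ (m + 1), g = ι (torus l * x) * diagE l' := by
  obtain ⟨y, hy, l', rfl⟩ := (mem_EDE_iff hp hϖ hz hz').1 hg
  obtain ⟨k, rfl⟩ := hm.exists_two_nsmul
  rw [smul_eq_mul, ED_eq_ED_succ hp hϖ hz hz', mem_ED_iff hp hϖ hz hz'] at hy
  obtain ⟨l, x, hx, rfl⟩ := hy
  exact ⟨l, l', x, hx, rfl⟩

/-- The value `γ(l) ψ_β(x) ζ(l')` depends only on the element `ι (l x) diag(1, l')`. -/
theorem gammaBetaZeta_well_defined (hp : ringChar 𝓀[F] ≠ 2) (hϖ : Irreducible ϖ) (hz : IsUnit z)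
    (hz' : ¬ IsSquare (z : F)) (hψ : HasConductorP ψ) {m : ℕ} {β : D z ϖ}
    (hβ : HasValD β (-(2 * m : ℤ))) {γ : E1 z →* ℂˣ} (ζ : E1 z →* ℂˣ)
    (hγ : MemLambda ψ β (m + 1) γ)
    {l l' k k' : E1 z} {x y : D1 z ϖ} (hx : x ∈ D1r z ϖ (m + 1)) (hy : y ∈ D1r z ϖ (m + 1))
    (h : ι (torus l * x) * diagE l' = ι (torus k * y) * diagE k') :
    (γ l : ℂ) * psiB ψ β x * ζ l' = γ k * psiB ψ β y * ζ k' := by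
  obtain ⟨h1, rfl⟩ := ι_mul_diagE_injective h
  have h2 : torus (l⁻¹ * k) = x * y⁻¹ := by
    rw [map_mul, map_inv, eq_mul_inv_iff_mul_eq, mul_assoc, ← h1, inv_mul_cancel_left]
  have h3 : torus (l⁻¹ * k) ∈ D1r z ϖ (m + 1) := h2 ▸ mul_mem hx (inv_mem hy)
  have h4 : x = torus (l⁻¹ * k) * y := by rw [h2, inv_mul_cancel_right]
  rw [h4, psiB_mul hp hϖ hz hz' hψ hβ h3 hy, ← hγ _ h3, map_mul, map_inv, Units.val_mul,
    ← mul_assoc, ← mul_assoc, Units.mul_inv, one_mul]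

theorem existsUnique_isGammaBetaZeta (hp : ringChar 𝓀[F] ≠ 2) (hϖ : Irreducible ϖ) (hz : IsUnit z)
    (hz' : ¬ IsSquare (z : F)) (hψ : HasConductorP ψ) {m : ℕ} (hm : Even m) {β : D z ϖ}
    (hβ : HasValD β (-(2 * m : ℤ))) {γ ζ : E1 z →* ℂˣ}
    (hγ : MemLambda ψ β (m + 1) γ) (hb : ∃ b : E z, β = ofE b) :
    ∃! χ : EDE z ϖ m →* ℂˣ, IsGammaBetaZeta ψ β (m + 1) γ ζ m χ := by
  choose l l' x hx hg using fun g : EDE z ϖ m => exists_eq_of_mem_EDE hp hϖ hz hz' hm g.2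
  have key : ∀ (g : EDE z ϖ m) (k k' : E1 z), ∀ y ∈ D1r z ϖ (m + 1),
      (g : U2 z ϖ) = ι (torus k * y) * diagE k' →
      (γ (l g) : ℂ) * psiB ψ β (x g) * ζ (l' g) = γ k * psiB ψ β y * ζ k' :=
    fun g k k' y hy h => gammaBetaZeta_well_defined hp hϖ hz hz' hψ hβ ζ hγ (hx g) hy
      ((hg g).symm.trans h)
  let f : EDE z ϖ m →* ℂ :=
    { toFun := fun g => (γ (l g) : ℂ) * psiB ψ β (x g) * ζ (l' g)
      map_one' := by
        rw [key 1 1 1 1 (one_mem _) (by simp), psiB_one]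
        simp
      map_mul' := fun g g' => by
        have := normal_D1r hp hϖ hz hz' (m + 1)
        have h1 : torus (l g')⁻¹ * x g * torus (l g') ∈ D1r z ϖ (m + 1) := by
          simpa using this.conj_mem _ (hx g) (torus (l g')⁻¹)
        have h2 := twist_mem_D1r hp hϖ hz hz' (l' g) (hx g')
        rw [key (g * g') (l g * l g') (l' g * l' g') _ (mul_mem h1 h2) ?_,
          psiB_mul hp hϖ hz hz' hψ hβ h1 h2]
        · obtain ⟨b, rfl⟩ := hb
          have h3 : psiB ψ (ofE b) (torus (l g')⁻¹ * x g * torus (l g')) =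
              psiB ψ (ofE b) (x g) := by
            refine psiB_ofE_congr b ?_
            have := E1.mul_star_self (l g')
            simp only [Submonoid.coe_mul, fstE_mul, sndE_mul, coe_torus, fstE_ofE, sndE_ofE,
              star_zero, mul_zero, zero_mul, add_zero]
            have h4 : (((l g')⁻¹ : E1 z) : E z) = star (l g' : E z) := rfl
            rw [h4]
            linear_combination fstE (x g : D z ϖ) * this
          rw [h3, psiB_ofE_congr b (fstE_twist (l' g) (x g'))]
          simp only [map_mul, Units.val_mul]
          ring
        · rw [Subgroup.coe_mul, hg g, hg g', mul_assoc, ← mul_assoc (diagE (l' g)), diagE_mul_ι,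
            twist_torus_mul]
          simp only [map_mul, mul_assoc, map_inv, mul_inv_cancel_left] }
  have hf : IsGammaBetaZeta ψ β (m + 1) γ ζ m f.toHomUnits :=
    fun k k' y hy g h => key g k k' y hy h
  refine ⟨f.toHomUnits, hf, fun χ hχ => MonoidHom.ext fun g => Units.ext ?_⟩
  rw [hχ _ _ _ (hx g) g (hg g), hf _ _ _ (hx g) g (hg g)]

end Existence

/-! ### Intertwining of `ψ_β` -/

section Duality

theorem trd_smul (t : F) (w : D z ϖ) : trd (t • w) = t * trd w := by
  simp [trd_eq, fstE]
  ring

theorem trd_mul_smul (t : F) (x w : D z ϖ) : trd (x * t • w) = t * trd (x * w) := by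
  rw [mul_smul_comm, trd_smul]

/-- The Cayley transform `(1 + w) / (1 - w)` of an element `w` of trace zero. As `w ^ 2 = -N(w)` is
a scalar, it differs from `1` by a multiple of `w - N(w)`. -/
theorem exists_cayley {w : D z ϖ} (hw : trd w = 0) (h2 : (2 : F) ≠ 0) (hn : 1 + nrd w ≠ 0) :
    ∃ y : D1 z ϖ, (y : D z ϖ) - 1 = (2 / (1 + nrd w)) • (w - algebraMap F (D z ϖ) (nrd w)) := by
  have hre : w.re = 0 := by
    rw [trd_eq] at hw
    exact (mul_eq_zero.1 hw).resolve_left h2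
  refine ⟨⟨1 + (2 / (1 + nrd w)) • (w - algebraMap F (D z ϖ) (nrd w)), ?_⟩, by simp⟩
  rw [mem_D1_iff]
  set n := nrd w with hndef
  have hn' : n = -z * w.imI ^ 2 - ϖ * w.imJ ^ 2 + ϖ * z * w.imK ^ 2 := by
    rw [hndef]
    simp [nrd, hre]
    ring
  rw [nrd_eq, normE_eq, normE_eq]
  simp [fstE, sndE, hre, QuaternionAlgebra.coe_algebraMap]
  field_simp
  rw [hn']
  ring

theorem smul_mem_PD {r : ℕ} {w : D z ϖ} (hw : w ∈ PD z ϖ r) {t : F}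
    (ht : valuation F t ≤ 1) : t • w ∈ PD z ϖ r := by
  obtain ⟨a, ha, rfl⟩ := hw
  refine ⟨t • a, ?_, by rw [smul_mul_assoc]⟩
  have h : ∀ c : E z, c ∈ OE z → t • c ∈ OE z := fun c hc =>
    (OE z).smul_mem hc (⟨t, ht⟩ : 𝒪[F])
  exact ⟨h _ ha.1, h _ ha.2⟩

theorem PD_sub {r : ℕ} {x y : D z ϖ} (hx : x ∈ PD z ϖ r) (hy : y ∈ PD z ϖ r) :
    x - y ∈ PD z ϖ r := by
  obtain ⟨a, ha, rfl⟩ := hx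
  obtain ⟨b, hb, rfl⟩ := hy
  exact ⟨a - b, sub_mem ha hb, by rw [sub_mul]⟩

variable [TopologicalSpace F] [IsNonarchimedeanLocalField F]

theorem valuation_nrd_lt_one (hp : ringChar 𝓀[F] ≠ 2) (hϖ : Irreducible ϖ) (hz : IsUnit z)
    (hz' : ¬ IsSquare (z : F)) {r : ℕ} {w : D z ϖ} (hw : w ∈ PD z ϖ (r + 1)) :
    valuation F (nrd w) < 1 := by
  have h1 := valuation_uniformizer_lt_one hϖ
  rw [mem_PD_iff hp hϖ hz hz'] at hw
  rw [nrd_eq]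
  refine Valuation.map_sub_lt _ ?_ ?_
  · rw [valuation_norm hp hz hz']
    refine pow_lt_one₀ zero_le (hw.1.trans_lt (pow_lt_one₀ zero_le h1 (by omega))) two_ne_zero
  · rw [map_mul, valuation_norm hp hz hz']
    exact (mul_le_of_le_one_right' (pow_le_one' (hw.2.trans (pow_le_one' h1.le _)) 2)).trans_lt h1

/-- An element `β` of trace zero for which `ψ_β` is trivial on `D¹_r` is orthogonal, modulo `P_F`,
to the elements of trace zero of `P_D^r`: for `w` among these, `ψ_β` takes the value
`ψ (2 t Tr(β w) / (1 + t² N(w)))` at the Cayley transform of `t w`. -/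
theorem valuation_trd_mul_lt_one_of_psiB (hp : ringChar 𝓀[F] ≠ 2) (hϖ : Irreducible ϖ)
    (hz : IsUnit z) (hz' : ¬ IsSquare (z : F)) {ψ : AddChar F ℂ} (hψ : HasConductorP ψ) {r : ℕ}
    {β w : D z ϖ} (hβ : trd β = 0) (h : ∀ y ∈ D1r z ϖ (r + 1), psiB ψ β y = 1)
    (hw : w ∈ PD z ϖ (r + 1)) (hw0 : trd w = 0) : valuation F (trd (β * w)) < 1 := by
  by_contra! hj
  obtain ⟨e, he, hψe⟩ := hψ.2
  have h2 := two_ne_zero_of_ringChar hp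
  set j := trd (β * w) with hjdef
  have hj0 : j ≠ 0 := fun h0 => by simp [h0] at hj
  -- the scalar `t` is chosen so that `2 t Tr(β w) = e`
  set t := e / (2 * j) with ht
  have htv : valuation F t ≤ 1 := by
    rw [ht, map_div₀, map_mul, valuation_two hp, one_mul]
    exact div_le_one_of_le₀ (he.trans hj) zero_le
  have htw := smul_mem_PD hw htv
  have hn := valuation_nrd_lt_one hp hϖ hz hz' htw
  set n := nrd (t • w) with hndef
  have hn1 : valuation F (1 + n) = 1 := Valuation.map_one_add_of_lt _ hn
  have hn0 : 1 + n ≠ 0 := fun h0 => by simp [h0] at hn1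
  obtain ⟨y, hy⟩ := exists_cayley (w := t • w) (by rw [trd_smul, hw0, mul_zero]) h2 hn0
  have hnPD : algebraMap F (D z ϖ) n ∈ PD z ϖ (r + 1) := by
    rw [hndef, ← self_mul_star_eq_nrd]
    refine PD_mul_right htw (star_mem_OD ?_)
    obtain ⟨a, ha, e⟩ := htw
    rw [e]
    exact mul_mem ha (pow_mem δ_mem_OD _)
  have hyr : y ∈ D1r z ϖ (r + 1) := by
    rw [mem_D1r, hy]
    refine smul_mem_PD (PD_sub htw hnPD) ?_
    rw [map_div₀, valuation_two hp, hn1, div_one]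
  have h1 := h y hyr
  have hval : trd (β * ((y : D z ϖ) - 1)) = e - e * n / (1 + n) := by
    have h3 : trd (β * algebraMap F (D z ϖ) n) = 0 := by
      rw [Algebra.algebraMap_eq_smul_one, trd_mul_smul, mul_one, hβ, mul_zero]
    rw [hy, ← hndef, trd_mul_smul, mul_sub, trd_sub, h3, sub_zero, trd_mul_smul, ← hjdef]
    have h5 : 2 * (t * j) = e := by
      rw [ht]
      field_simp
    rw [div_mul_eq_mul_div, h5]
    field_simp
    ring
  have h4 : ψ (-(e * n / (1 + n))) = 1 := by
    refine hψ.1 _ ?_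
    rw [Valuation.map_neg, map_div₀, hn1, div_one, map_mul]
    exact (mul_le_of_le_one_left' he).trans_lt hn
  rw [psiB, hval, sub_eq_add_neg, AddChar.map_add_eq_mul, h4, mul_one] at h1
  exact hψe h1

theorem absE_le_of_psiB_eq_one (hp : ringChar 𝓀[F] ≠ 2) (hϖ : Irreducible ϖ)
    (hz : IsUnit z) (hz' : ¬ IsSquare (z : F)) {ψ : AddChar F ℂ} (hψ : HasConductorP ψ) {k : ℕ}
    {β : D z ϖ} (hβ : trd β = 0) (h : ∀ y ∈ D1r z ϖ (2 * k + 1), psiB ψ β y = 1) :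
    absE (fstE β) ≤ (valuation F (ϖ : F) ^ k)⁻¹ ∧
      absE (sndE β) ≤ (valuation F (ϖ : F) ^ k)⁻¹ := by
  have h0 := valuation_uniformizer_ne_zero hϖ
  have h0' := zero_lt_iff.2 h0
  have h2 := two_ne_zero_of_ringChar hp
  have hz1 : valuation F (z : F) = 1 := isUnit_iff_valuation_eq_one.1 hz
  have hre : β.re = 0 := by
    rw [trd_eq] at hβ
    exact (mul_eq_zero.1 hβ).resolve_left h2
  have key : ∀ w ∈ PD z ϖ (2 * k + 1), trd w = 0 → ∀ b u : F, valuation F u = 1 →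
      trd (β * w) = u * (b * (ϖ : F) ^ (k + 1)) →
      valuation F b ≤ (valuation F (ϖ : F) ^ k)⁻¹ := by
    intro w hw hw0 b u hu e
    have h1 := valuation_trd_mul_lt_one_of_psiB hp hϖ hz hz' hψ hβ h hw hw0
    rw [e, map_mul, hu, one_mul, valuation_lt_one_iff_le hϖ, map_mul, map_pow, pow_succ,
      ← mul_assoc] at h1
    rw [← mul_one (valuation F (ϖ : F) ^ k)⁻¹, le_inv_mul_iff₀ (zero_lt_iff.2 (pow_ne_zero k h0)),
      mul_comm]
    exact (mul_le_iff_le_one_left h0').1 h1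
  have hpd : ∀ w : D z ϖ, absE (fstE w) ≤ valuation F (ϖ : F) ^ (k + 1) →
      absE (sndE w) ≤ valuation F (ϖ : F) ^ k → w ∈ PD z ϖ (2 * k + 1) := by
    intro w h3 h4
    rw [mem_PD_iff hp hϖ hz hz', show (2 * k + 1 + 1) / 2 = k + 1 by omega,
      show (2 * k + 1) / 2 = k by omega]
    exact ⟨h3, h4⟩
  have hI := key (mkD ⟨0, (ϖ : F) ^ (k + 1)⟩ 0) (hpd _ (by simp [absE]) (by simp))
    (by simp [trd_eq]) β.imI (2 * z) (by rw [map_mul, valuation_two hp, hz1, mul_one])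
    (by simp [trd_eq, fstE, mkD]; ring)
  have hJ := key (mkD 0 ⟨(ϖ : F) ^ k, 0⟩) (hpd _ (by simp) (by simp [absE]))
    (by simp [trd_eq]) β.imJ 2 (valuation_two hp)
    (by rw [trd_eq]; congr 1; simp [fstE, mkD]; ring)
  have hK := key (mkD 0 ⟨0, (ϖ : F) ^ k⟩) (hpd _ (by simp) (by simp [absE]))
    (by simp [trd_eq]) β.imK (-(2 * z))
    (by rw [Valuation.map_neg, map_mul, valuation_two hp, hz1, mul_one])
    (by simp [trd_eq, fstE, mkD]; ring)
  refine ⟨absE_le_iff.2 ⟨?_, hI⟩, absE_le_iff.2 ⟨hJ, hK⟩⟩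
  rw [show (fstE β).re = 0 from hre, map_zero]
  exact zero_le

end Duality

section Intertwining

variable [TopologicalSpace F] [IsNonarchimedeanLocalField F]

/-- If `x` intertwines `ψ_β` on `D¹_{2k+1}`, then `x β x⁻¹ - β` lies in `ϖ^{-k} O_D`. -/
theorem absE_conj_sub_le (hp : ringChar 𝓀[F] ≠ 2) (hϖ : Irreducible ϖ)
    (hz : IsUnit z) (hz' : ¬ IsSquare (z : F)) {ψ : AddChar F ℂ} (hψ : HasConductorP ψ) {k : ℕ}
    {β : D z ϖ} {x : D1 z ϖ}
    (h : ∀ y ∈ D1r z ϖ (2 * k + 1), psiB ψ β (x⁻¹ * y * x) = psiB ψ β y) :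
    absE (fstE ((x : D z ϖ) * β * star (x : D z ϖ) - β)) ≤ (valuation F (ϖ : F) ^ k)⁻¹ ∧
      absE (sndE ((x : D z ϖ) * β * star (x : D z ϖ) - β)) ≤ (valuation F (ϖ : F) ^ k)⁻¹ := by
  have hx : star (x : D z ϖ) * (x : D z ϖ) = 1 := Unitary.star_mul_self_of_mem x.2
  refine absE_le_of_psiB_eq_one hp hϖ hz hz' hψ ?_ fun y hy => ?_
  · rw [trd_sub, trd_mul_comm, ← mul_assoc, hx, one_mul, sub_self]
  · have h1 := h y hy
    have e : trd (β * (((x⁻¹ * y * x : D1 z ϖ) : D z ϖ) - 1)) =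
        trd ((x : D z ϖ) * β * star (x : D z ϖ) * ((y : D z ϖ) - 1)) := by
      have e1 : ((x⁻¹ * y * x : D1 z ϖ) : D z ϖ) - 1 =
          star (x : D z ϖ) * ((y : D z ϖ) - 1) * x := by
        rw [Submonoid.coe_mul, Submonoid.coe_mul, coe_inv_D1, mul_sub, sub_mul, mul_one, hx]
      rw [e1, ← mul_assoc, trd_mul_comm]
      simp only [mul_assoc]
    rw [psiB, e] at h1
    have h2 : ψ (trd ((x : D z ϖ) * β * star (x : D z ϖ) * ((y : D z ϖ) - 1))) =
        psiB ψ ((x : D z ϖ) * β * star (x : D z ϖ) - β) y * psiB ψ β y := by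
      rw [psiB, psiB, ← AddChar.map_add_eq_mul, ← trd_add, sub_mul, sub_add_cancel]
    rw [h2] at h1
    exact (mul_eq_right₀ (psiB_ne_zero β y)).1 h1

/-- The element `λ = (1 + α) / (1 - α)` of `E¹`, for which `λ ^ 2 - 1` is a unit. -/
theorem exists_absE_sq_sub_one_eq_one (hp : ringChar 𝓀[F] ≠ 2) (hz : IsUnit z)
    (hz' : ¬ IsSquare (z : F)) : ∃ l : E1 z, absE ((l : E z) ^ 2 - 1) = 1 := by
  have h1 : valuation F (1 - z : F) = 1 := by
    have := valuation_one_sub_mul_sq_eq_one hp hz hz' (t := 1) (map_one _).le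
    rwa [one_pow, mul_one] at this
  have h0 : (1 - z : F) ≠ 0 := fun h => by simp [h] at h1
  let l : E1 z := ⟨⟨(1 + z) / (1 - z), 2 / (1 - z)⟩, by
    rw [← QuadraticAlgebra.norm_eq_one_iff_mem_unitary, normE_eq]
    field_simp
    ring⟩
  refine ⟨l, ?_⟩
  have e : (l : E z) ^ 2 - 1 = l * ((l : E z) - star (l : E z)) := by
    rw [mul_sub, E1.mul_star_self, pow_two]
  have e2 : (l : E z) - star (l : E z) = ⟨0, 2 * 2 / (1 - z)⟩ := by
    ext
    · simp [l]
    · simp [l]; ring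
  rw [e, absE_mul hp hz hz', absE_eq_one_of_norm hp hz hz', one_mul, e2]
  simp [absE, map_div₀, map_mul, valuation_two hp, h1]

/-- If `ψ_β` is invariant under conjugation by `E¹`, then `β` is congruent to an element of `E`. -/
theorem absE_sndE_le_of_invariant (hp : ringChar 𝓀[F] ≠ 2) (hϖ : Irreducible ϖ)
    (hz : IsUnit z) (hz' : ¬ IsSquare (z : F)) {ψ : AddChar F ℂ} (hψ : HasConductorP ψ) {k : ℕ}
    {β : D z ϖ} (h : ∀ l : E1 z, ∀ y ∈ D1r z ϖ (2 * k + 1),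
      psiB ψ β ((torus l)⁻¹ * y * torus l) = psiB ψ β y) :
    absE (sndE β) ≤ (valuation F (ϖ : F) ^ k)⁻¹ := by
  obtain ⟨l, hl⟩ := exists_absE_sq_sub_one_eq_one hp hz hz'
  have h1 := (absE_conj_sub_le hp hϖ hz hz' hψ (h l)).2
  have e : sndE (((torus l : D1 z ϖ) : D z ϖ) * β * star ((torus l : D1 z ϖ) : D z ϖ) - β) =
      ((l : E z) ^ 2 - 1) * sndE β := by
    simp only [sndE_sub, sndE_mul, fstE_mul, coe_torus, fstE_star, sndE_star, fstE_ofE, sndE_ofE,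
      star_star, neg_zero, mul_zero, zero_mul, add_zero, zero_add]
    ring
  rwa [e, absE_mul hp hz hz', hl, one_mul] at h1

/-- For `β = a + c δ` with `a` of valuation `-2k` and `c` in `ϖ^{-k} O_E`, the elements that
intertwine `ψ_β` on `D¹_{2k+1}` lie in `E¹ D¹_{2k}`: modulo `ϖ^{-k}` the commutator of
`x = u + d δ` and `β` has second component `-2 a d`. -/
theorem mem_ED_of_intertwines (hp : ringChar 𝓀[F] ≠ 2) (hϖ : Irreducible ϖ)
    (hz : IsUnit z) (hz' : ¬ IsSquare (z : F)) {ψ : AddChar F ℂ} (hψ : HasConductorP ψ) {k : ℕ}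
    {β : D z ϖ} (hβ0 : trd β = 0) (ha : absE (fstE β) = (valuation F (ϖ : F) ^ (2 * k))⁻¹)
    (hc : absE (sndE β) ≤ (valuation F (ϖ : F) ^ k)⁻¹) {x : D1 z ϖ}
    (h : ∀ y ∈ D1r z ϖ (2 * k + 1), psiB ψ β (x⁻¹ * y * x) = psiB ψ β y) :
    x ∈ ED z ϖ (2 * k) := by
  have h0 := valuation_uniformizer_ne_zero hϖ
  have hpk : valuation F (ϖ : F) ^ k ≠ 0 := pow_ne_zero k h0
  obtain ⟨h1, h2⟩ := absE_conj_sub_le hp hϖ hz hz' hψ h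
  set β' := (x : D z ϖ) * β * star (x : D z ϖ) - β with hβ'
  have hx : star (x : D z ϖ) * (x : D z ϖ) = 1 := Unitary.star_mul_self_of_mem x.2
  obtain ⟨hx1, hx2⟩ := absE_le_one_of_D1 hp hϖ hz hz' x
  have hstar : star (fstE β) = -fstE β := by
    have hre : (fstE β).re = 0 := by
      rw [trd_eq] at hβ0
      exact (mul_eq_zero.1 hβ0).resolve_left (two_ne_zero_of_ringChar hp)
    ext <;> simp [hre]
  have hcomm : (x : D z ϖ) * β = β' * x + β * x := by
    rw [hβ', sub_mul, sub_add_cancel, mul_assoc _ (star (x : D z ϖ)), hx, mul_one]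
  have e : fstE β * (algebraMap 𝒪[F] (E z) 2 * sndE (x : D z ϖ)) =
      fstE (x : D z ϖ) * sndE β - sndE β * star (fstE (x : D z ϖ)) -
        (fstE β' * sndE (x : D z ϖ) + sndE β' * star (fstE (x : D z ϖ))) := by
    have h3 := congrArg sndE hcomm
    rw [sndE_add, sndE_mul, sndE_mul, sndE_mul, hstar] at h3
    rw [map_ofNat]
    linear_combination -h3
  have h4 : absE (fstE β * (algebraMap 𝒪[F] (E z) 2 * sndE (x : D z ϖ))) ≤
      (valuation F (ϖ : F) ^ k)⁻¹ := by
    rw [e]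
    refine absE_sub_le (absE_sub_le ?_ ?_) (absE_add_le ?_ ?_)
    · rw [absE_mul hp hz hz']
      exact (mul_le_of_le_one_left' hx1).trans hc
    · rw [absE_mul hp hz hz', absE_star]
      exact (mul_le_of_le_one_right' hx1).trans hc
    · rw [absE_mul hp hz hz']
      exact (mul_le_of_le_one_right' hx2).trans h1
    · rw [absE_mul hp hz hz', absE_star]
      exact (mul_le_of_le_one_right' hx1).trans h2
  have h2v : valuation F ((2 : 𝒪[F]) : F) = 1 := valuation_two hp
  rw [absE_mul hp hz hz', absE_mul hp hz hz', absE_algebraMap, h2v, one_mul, ha,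
    inv_mul_le_iff₀ (zero_lt_iff.2 (pow_ne_zero _ h0)), two_mul, pow_add, mul_assoc,
    mul_inv_cancel₀ hpk, mul_one] at h4
  obtain ⟨l, y, hy, rfl⟩ := exists_torus_mul_of_sndE_le hp hϖ hz hz' h4
  exact (mem_ED_iff hp hϖ hz hz').2 ⟨l, y, D1r_succ_le hy, rfl⟩

end Intertwining

/-! ### Irreducibility -/

section Irreducibility

variable {ψ : AddChar F ℂ} {β : D z ϖ} {γ ζ : E1 z →* ℂˣ}

theorem ι_mem_EDE {r : ℕ} {x : D1 z ϖ} (hx : x ∈ ED z ϖ r) : ι x ∈ EDE z ϖ r :=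
  Subgroup.mem_sup_left ⟨x, hx, rfl⟩

theorem diagE_mem_EDE {r : ℕ} (l : E1 z) : diagE l ∈ EDE z ϖ r :=
  Subgroup.mem_sup_right ⟨l, rfl⟩

theorem D1r_le_ED {r : ℕ} : D1r z ϖ r ≤ ED z ϖ r := le_sup_right

theorem gammaBetaZeta_ι {m : ℕ} {χ : EDE z ϖ m →* ℂˣ}
    (hχ : IsGammaBetaZeta ψ β (m + 1) γ ζ m χ) {x : D1 z ϖ} (hx : x ∈ D1r z ϖ (m + 1))
    (h : ι x ∈ EDE z ϖ m) : (χ ⟨ι x, h⟩ : ℂ) = psiB ψ β x := by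
  rw [hχ 1 1 x hx _ (by simp)]
  simp

/-- A character takes equal values at elements conjugate under its own domain. -/
theorem map_conj_eq {m : ℕ} (χ : EDE z ϖ m →* ℂˣ) {g h : U2 z ϖ} (hg : g ∈ EDE z ϖ m)
    (hh : h ∈ EDE z ϖ m) (hgh : g⁻¹ * h * g ∈ EDE z ϖ m) : χ ⟨g⁻¹ * h * g, hgh⟩ = χ ⟨h, hh⟩ := by
  have : (⟨g⁻¹ * h * g, hgh⟩ : EDE z ϖ m) = ⟨g, hg⟩⁻¹ * ⟨h, hh⟩ * ⟨g, hg⟩ := rfl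
  rw [this, map_mul, map_mul, map_inv, mul_comm, mul_inv_cancel_left]

variable [TopologicalSpace F] [IsNonarchimedeanLocalField F]

/-- The kernel of `γ_{(β, ζ)}` is open: close to `1` in `U(2)`, the component in `D¹` lies in
`D¹_{2m+1}`, and `ζ` is trivial at the component in `E¹`. -/
theorem isOpen_ker_gammaBetaZeta (hp : ringChar 𝓀[F] ≠ 2) (hϖ : Irreducible ϖ)
    (hz : IsUnit z) (hz' : ¬ IsSquare (z : F)) (hψ : HasConductorP ψ) {m : ℕ}
    (hβ : HasValD β (-(2 * m : ℤ))) (hζ : Continuous ζ) {χ : EDE z ϖ m →* ℂˣ}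
    (hχ : IsGammaBetaZeta ψ β (m + 1) γ ζ m χ) :
    IsOpen ((χ.ker.map (EDE z ϖ m).subtype : Subgroup (U2 z ϖ)) : Set (U2 z ϖ)) := by
  have h0 := valuation_uniformizer_ne_zero hϖ
  have hp1 := (valuation_uniformizer_lt_one hϖ).le
  refine Subgroup.isOpen_of_mem_nhds _ (g := 1) ?_
  have hmat : Continuous (U2.mat (z := z) (ϖ := ϖ)) :=
    Units.continuous_val.comp continuous_subtype_val
  have h00 : Continuous fun g : U2 z ϖ => U2.mat g 0 0 := hmat.matrix_elem 0 0
  have h01 : Continuous fun g : U2 z ϖ => U2.mat g 0 1 := hmat.matrix_elem 0 1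
  have hdet : Continuous fun g : U2 z ϖ => (U2.mat g).det := hmat.matrix_det
  have hζ1 := eventually_character_eq_one hp hz hz' hζ
  rw [nhds_subtype, Filter.eventually_comap] at hζ1
  have hb := fun b : E z => (hasBasis_nhds_E b).mem_of_mem (pow_ne_zero (m + 1) h0)
  have e00 := h00.continuousAt (x := 1) |>.eventually (hb _)
  have e01 := h01.continuousAt (x := 1) |>.eventually (hb _)
  have edet : ∀ᶠ g in nhds (1 : U2 z ϖ), ∀ a : E1 z, (a : E z) = (U2.mat g).det → ζ a = 1 :=
    (hdet.tendsto' 1 ((1 : E1 z) : E z) Matrix.det_one).eventually hζ1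
  filter_upwards [e00, e01, edet] with g hg0 hg1 hg2
  obtain ⟨x, l, rfl, hx0, hx1, hl⟩ := exists_eq_ι_mul_diagE hϖ.ne_zero g
  have hζl := hg2 l hl
  have hx : x ∈ D1r z ϖ (2 * m + 1) := by
    rw [mem_D1r, mem_PD_iff hp hϖ hz hz', show (2 * m + 1 + 1) / 2 = m + 1 by omega,
      show (2 * m + 1) / 2 = m by omega, fstE_sub, sndE_sub, hx0, hx1, fstE_one, sndE_one,
      sub_zero, absE_mul hp hz hz', absE_star, absE_eq_one_of_norm hp hz hz', mul_one]
    have hg0' : absE (U2.mat (ι x * diagE l) 0 0 - 1) < valuation F (ϖ : F) ^ (m + 1) := hg0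
    have hg1' : absE (U2.mat (ι x * diagE l) 0 1 - 0) < valuation F (ϖ : F) ^ (m + 1) := hg1
    rw [sub_zero] at hg1'
    exact ⟨hg0'.le, hg1'.le.trans (pow_le_pow_right_of_le_one' hp1 (Nat.le_succ m))⟩
  have hle : D1r z ϖ (2 * m + 1) ≤ D1r z ϖ (m + 1) := antitone_nat_of_succ_le
    (fun r => D1r_succ_le (z := z) (ϖ := ϖ) (r := r)) (by omega)
  have hmem : ι x * diagE l ∈ EDE z ϖ m :=
    mul_mem (ι_mem_EDE (D1r_le_ED (D1r_succ_le (hle hx)))) (diagE_mem_EDE l)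
  refine ⟨⟨_, hmem⟩, ?_, rfl⟩
  rw [SetLike.mem_coe, MonoidHom.mem_ker]
  refine Units.ext ?_
  rw [hχ 1 l x (hle hx) _ (by simp), psiB_eq_one_of_mem hp hϖ hz hz' hψ hβ hx, hζl]
  simp

/-- Only the elements of `E¹ D¹_m ⋊ E¹` intertwine `γ_{(β, ζ)}`. -/
theorem exists_gammaBetaZeta_ne (hp : ringChar 𝓀[F] ≠ 2) (hϖ : Irreducible ϖ)
    (hz : IsUnit z) (hz' : ¬ IsSquare (z : F)) (hψ : HasConductorP ψ) {m : ℕ} (hm : Even m)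
    (hβ0 : trd β = 0) (hβ : HasValD β (-(2 * m : ℤ))) {χ : EDE z ϖ m →* ℂˣ}
    (hχ : IsGammaBetaZeta ψ β (m + 1) γ ζ m χ) {g : U2 z ϖ} (hg : g ∉ EDE z ϖ m) :
    ∃ h : EDE z ϖ m, ∃ hgh : g⁻¹ * h * g ∈ EDE z ϖ m, χ h ≠ χ ⟨g⁻¹ * h * g, hgh⟩ := by
  by_contra! hcon
  have hnorm := normal_D1r hp hϖ hz hz' (m + 1)
  have hιm : ∀ y ∈ D1r z ϖ (m + 1), ι y ∈ EDE z ϖ m :=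
    fun y hy => ι_mem_EDE (D1r_le_ED (D1r_succ_le hy))
  have hconj : ∀ (x : D1 z ϖ), ∀ y ∈ D1r z ϖ (m + 1), x⁻¹ * y * x ∈ D1r z ϖ (m + 1) :=
    fun x y hy => by simpa using hnorm.conj_mem y hy x⁻¹
  have hinv : ∀ l : E1 z, ∀ y ∈ D1r z ϖ (m + 1),
      psiB ψ β ((torus l)⁻¹ * y * torus l) = psiB ψ β y := by
    intro l y hy
    have hl : ι (torus l) ∈ EDE z ϖ m := ι_mem_EDE (Subgroup.mem_sup_left ⟨l, rfl⟩)
    have h1 : (ι (torus l))⁻¹ * ι y * ι (torus l) = ι ((torus l)⁻¹ * y * torus l) := by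
      simp only [map_mul, map_inv]
    have h2 := hιm _ (hconj (torus l) y hy)
    rw [← gammaBetaZeta_ι hχ hy (hιm y hy), ← gammaBetaZeta_ι hχ (hconj _ y hy) h2,
      ← map_conj_eq χ hl (hιm y hy) (h1 ▸ h2)]
    simp only [h1]
  obtain ⟨x, l, rfl, -⟩ := exists_eq_ι_mul_diagE hϖ.ne_zero g
  have hx : ∀ y ∈ D1r z ϖ (m + 1), psiB ψ β (x⁻¹ * y * x) = psiB ψ β y := by
    intro y hy
    have h1 : (ι x * diagE l)⁻¹ * ι y * (ι x * diagE l) =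
        (diagE l)⁻¹ * ι (x⁻¹ * y * x) * diagE l := by
      simp only [map_mul, map_inv, mul_inv_rev, mul_assoc]
    have h2 := hιm _ (hconj x y hy)
    have h3 : (diagE l)⁻¹ * ι (x⁻¹ * y * x) * diagE l ∈ EDE z ϖ m :=
      mul_mem (mul_mem (inv_mem (diagE_mem_EDE l)) h2) (diagE_mem_EDE l)
    have h4 := hcon ⟨ι y, hιm y hy⟩ (h1 ▸ h3)
    simp only [h1] at h4
    rw [map_conj_eq χ (diagE_mem_EDE l) h2 h3] at h4
    rw [← gammaBetaZeta_ι hχ hy (hιm y hy), ← gammaBetaZeta_ι hχ (hconj _ y hy) h2, h4]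
  obtain ⟨k, rfl⟩ := hm.exists_two_nsmul
  rw [smul_eq_mul] at *
  refine hg (mul_mem (ι_mem_EDE ?_) (diagE_mem_EDE l))
  exact mem_ED_of_intertwines hp hϖ hz hz' hψ hβ0 (absE_of_hasValD hp hϖ hz hz' hβ).1
    (absE_sndE_le_of_invariant hp hϖ hz hz' hψ hinv) hx

end Irreducibility

end UTwo

end

open UTwo
theorem mainTheorem8 {F : Type*} [Field F] [ValuativeRel F] [TopologicalSpace F]
    [IsNonarchimedeanLocalField F] (hp : ringChar 𝓀[F] ≠ 2)
    (ϖ : 𝒪[F]) (hϖ : Irreducible ϖ)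
    (z : 𝒪[F]) (hz : IsUnit z) (hz' : ¬ IsSquare (z : F))
    (m : ℕ) (hm : 1 ≤ m) (hr : Odd (m + 1)) :
    -- `E¹ D¹_{r-1} / D¹_{n+1} = E¹ D¹_r / D¹_{n+1}` for `r = m + 1`, `n = 2 m`
    ((∀ k : ℕ, (D1r z ϖ k).Normal) ∧
      ((fun g : D1 z ϖ => (g : D1 z ϖ ⧸ D1r z ϖ (2 * m + 1))) ''
          (((torus (z := z) (ϖ := ϖ)).range : Set (D1 z ϖ)) * (D1r z ϖ m : Set (D1 z ϖ))) =
        (fun g : D1 z ϖ => (g : D1 z ϖ ⧸ D1r z ϖ (2 * m + 1))) ''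
          (((torus (z := z) (ϖ := ϖ)).range : Set (D1 z ϖ)) * (D1r z ϖ (m + 1) : Set (D1 z ϖ)))) ∧
      ED z ϖ m = ED z ϖ (m + 1)) ∧
    ∀ (ψ : AddChar F ℂ), HasConductorP ψ →
    ∀ β : D z ϖ, trd β = 0 → HasValD β (-(2 * m : ℤ)) →
    ∀ (γ ζ : E1 z →* ℂˣ), Continuous γ → Continuous ζ → MemLambda ψ β (m + 1) γ →
      -- the character `γ_{(β, ζ)}` of `E¹ D¹_{r-1} ⋊ E¹` exists for `β` in `E⁰`
      ((∃ b : E z, β = ofE b) →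
        ∃! χ : EDE z ϖ m →* ℂˣ, IsGammaBetaZeta ψ β (m + 1) γ ζ m χ) ∧
      -- whenever it exists, the induced representation is irreducible and admissible
      ∀ χ : EDE z ϖ m →* ℂˣ, IsGammaBetaZeta ψ β (m + 1) γ ζ m χ →
        (cInd (EDE z ϖ m) χ).IsIrreducible ∧ IsAdmissibleRep (cInd (EDE z ϖ m) χ) := by
  have hme : Even m := by
    rw [Nat.odd_add_one, Nat.not_odd_iff_even] at hr
    exact hr
  refine ⟨⟨normal_D1r hp hϖ hz hz', ?_⟩, ?_⟩
  · obtain ⟨k, rfl⟩ := hme.exists_two_nsmul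
    rw [smul_eq_mul]
    exact ⟨by rw [torus_mul_D1r_eq hp hϖ hz hz'], ED_eq_ED_succ hp hϖ hz hz' k⟩
  · intro ψ hψ β hβ0 hβ γ ζ _ hζ hγ
    refine ⟨existsUnique_isGammaBetaZeta hp hϖ hz hz' hψ hme hβ hγ, fun χ hχ => ?_⟩
    have := compactSpace_U2 hp hϖ hz hz'
    refine ⟨isIrreducible_cInd (isOpen_ker_gammaBetaZeta hp hϖ hz hz' hψ hβ hζ hχ)
      (Subgroup.map_subtype_le _) (fun k hk => ?_)
      (fun g hg => exists_gammaBetaZeta_ne hp hϖ hz hz' hψ hme hβ0 hβ hχ hg),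
      isAdmissibleRep_cInd _ _⟩
    obtain ⟨h, hh, rfl⟩ := hk
    exact hh
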